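/- Let $\mathcal H\neq\{0\}$ be a separable complex Hilbert space, $(\Omega,\Sigma)$ a measurable space, $\mathcal I:\Sigma\to\mathcal L(\mathcal T(\mathcal H))$ an instrument (a $\sigma$-additive family of completely positive linear maps on the trace-class operators, with $\mathcal I(\Omega)$ trace preserving), with dual maps $\mathcal I^*(X)$ given by $\operatorname{tr}[\mathcal I^*(X)(B)T]=\operatorname{tr}[B\,\mathcal I(X)(T)]$, and let $\mathsf M:\Sigma\to\mathcal L(\mathcal H)$ be the associated observable, i.e. the normalized POVM with $\operatorname{tr}[\mathsf M(X)\rho]=\operatorname{tr}[\mathcal I(X)(\rho)]$ for all states $\rho$. Let $\mu$ be a $\sigma$-finite measure (for instance a probability measure) on $(\Omega,\Sigma)$ such that $\mu$ and $\mathsf M$ are mutually absolutely continuous. For $n\in\{0,1,2,\dots\}\cup\{\infty\}$ let $\mathcal H_n$ be the standard $n$-dimensional Hilbert space. Let $(\mathcal H'_\oplus,\mathsf P',Y)$ be a minimal Stinespring dilation of $\mathcal I$, where $\mathcal H'_\oplus=\int^\oplus_\Omega\mathcal H_{r(x)}\,d\mu(x)$ for a measurable $r$, $\mathsf P'(X)$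 is multiplication by $\chi_X$, and $Y:\mathcal H\to\mathcal H\otimes\mathcal H'_\oplus$ is a linear isometry; that is, $\mathcal I^*(X)(B)=Y^*(B\otimes\mathsf P'(X))Y$ for all $X\in\Sigma$, $B\in\mathcal L(\mathcal H)$, and the vectors $(B\otimes\mathsf P'(X))Y\psi$ span a dense subspace of $\mathcal H\otimes\mathcal H'_\oplus$. The observable $\mathsf M$ is called rank-$\infty$ if $m(x)=\infty$ for $\mu$-almost all $x$, where $m$ is the ($\mu$-a.e. unique) multiplicity function in a minimal Naimark dilation $(\int^\oplus_\Omega\mathcal H_{m(x)}\,d\mu(x),\,X\mapsto\hat\chi_X,\,J)$ of $\mathsf M$. A normal measurement realization of an instrument $\mathcal I$ is a quadruple $(\mathcal K,\mathsf P,U,\xi)$ of a Hilbert space $\mathcal K$, a projection valued measure $\mathsf P$ on $\mathcal K$, a unitary $U$ on $\mathcal H\otimes\mathcal K$ and a unit vector $\xi\in\mathcal K$ such that $\mathcal I^*(X)(B)=Y_\xi^*U^*(B\otimes\mathsf P(X))UY_\xi$ for all $X$ and $B$, where $Y_\xi\psi=\psi\otimes\xi$. It is minimal if $(\mathcal K,\mathsf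 P,UY_\xi)$ is a minimal Stinespring dilation of $\mathcal I$ and, for every normal measurement realization $(\mathcal K',\mathsf P'',U'',\xi'')$ of $\mathcal I$, there is a linear isometry $W:\mathcal K\to\mathcal K'$ with $W\mathsf P(X)=\mathsf P''(X)W$ for all $X\in\Sigma$ and $(1\otimes W)U(\psi\otimes\xi)=U''(\psi\otimes\xi'')$ for all $\psi\in\mathcal H$ (so that $\mathcal K$ has the least possible dimension). Then: (i) Suppose $\mathsf M$ is not rank-$\infty$. Then $\mathcal H'_\oplus$ contains unit vectors, and for every unit vector $\xi\in\mathcal H'_\oplus$ there is a unitary operator $U$ on $\mathcal H\otimes\mathcal H'_\oplus$ with $U(\psi\otimes\xi)=Y\psi$ for all $\psi\in\mathcal H$; for every such $U$ and $\xi$, $(\mathcal H'_\oplus,\mathsf P',U,\xi)$ is a minimal normal measurement realization of $\mathcal I$. (ii) Suppose $\mathsf M$ is rank-$\infty$. (a) If $U$ is a unitary operator on $\mathcal H\otimes\mathcal H'_\oplus$ and $\xi\in\mathcal H'_\oplus$ a unit vector such that $U(\psi\otimes\xi)=Y\psi$ for all $\psi\in\mathcal H$, then $(\mathcal H'_\oplus,\mathsf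 P',U,\xi)$ is a minimal normal measurement realization of $\mathcal I$. (b) If there are no such $U$ and $\xi$, let $x_0\notin\Omega$, let $\Sigma_+$ be the smallest $\sigma$-algebra on $\Omega\cup\{x_0\}$ containing $\Sigma$, let $\mathcal K=\mathcal H'_\oplus\oplus\mathbb C$, let $\mathsf P'_+:\Sigma_+\to\mathcal L(\mathcal K)$ be determined by $\mathsf P'_+(X)(\eta,c)=(\mathsf P'(X)\eta,0)$ for $X\in\Sigma$ and $\mathsf P'_+(\{x_0\})(\eta,c)=(0,c)$, and let $Y_+\psi=(Y\psi,0)\in(\mathcal H\otimes\mathcal H'_\oplus)\oplus\mathcal H\cong\mathcal H\otimes\mathcal K$. Let $\mathcal I_+(S)=\mathcal I(S\cap\Omega)$ for $S\in\Sigma_+$. Then $\mathcal I_+$ is an instrument with $\mathcal I_+(X)=\mathcal I(X)$ for $X\in\Sigma$ and $\mathcal I_+(\{x_0\})=0$; for every unit vector $\xi_+\in\mathcal K$ there is a unitary operator $U_+$ on $\mathcal H\otimes\mathcal K$ with $U_+(\psi\otimes\xi_+)=Y_+\psi$ for all $\psi\in\mathcal H$; and for every such $U_+$ and $\xi_+$,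 $(\mathcal K,\mathsf P'_+,U_+,\xi_+)$ is a normal measurement realization of $\mathcal I_+$. -/

import Mathlib

open MeasureTheory
open scoped TensorProduct ComplexOrder InnerProductSpace ENNReal

universe u v w t

noncomputable section

namespace QMeas

/-! ## Trace-class operators -/

section TraceClass

variable (H : Type v) [NormedAddCommGroup H] [InnerProductSpace ℂ H]

/-- The trace-class operators of a Hilbert space `H`: the operators
`T = ∑ₙ |aₙ⟩⟨bₙ|` with `∑ₙ ‖aₙ‖ ‖bₙ‖ < ∞` (on a Hilbert space these are exactly the
operators with `tr |T| < ∞`). -/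
def traceClass : Submodule ℂ (H →L[ℂ] H) where
  carrier := {T | ∃ a b : ℕ → H, Summable (fun n => ‖a n‖ * ‖b n‖) ∧
    ∀ x, HasSum (fun n => ⟪b n, x⟫_ℂ • a n) (T x)}
  zero_mem' := ⟨fun _ => 0, fun _ => 0, by simp,
    fun x => by simp⟩
  add_mem' := by
    rintro S T ⟨a, b, hab, hS⟩ ⟨c, d, hcd, hT⟩
    obtain ⟨e⟩ : Nonempty (ℕ ≃ ℕ ⊕ ℕ) := ⟨Equiv.natSumNatEquivNat.symm⟩
    refine ⟨fun n => Sum.elim a c (e n), fun n => Sum.elim b d (e n), ?_, fun x => ?_⟩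
    · have h : Summable (fun z : ℕ ⊕ ℕ => ‖Sum.elim a c z‖ * ‖Sum.elim b d z‖) :=
        (HasSum.sum (f := fun z : ℕ ⊕ ℕ => ‖Sum.elim a c z‖ * ‖Sum.elim b d z‖)
          hab.hasSum hcd.hasSum).summable
      exact e.summable_iff.2 h
    · have h : HasSum (fun z : ℕ ⊕ ℕ => ⟪Sum.elim b d z, x⟫_ℂ • Sum.elim a c z) (S x + T x) :=
        HasSum.sum (f := fun z : ℕ ⊕ ℕ => ⟪Sum.elim b d z, x⟫_ℂ • Sum.elim a c z)
          (hS x) (hT x)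
      exact e.hasSum_iff.2 h
  smul_mem' := by
    rintro k T ⟨a, b, hab, hT⟩
    refine ⟨fun n => k • a n, b, ?_, fun x => ?_⟩
    · simpa [norm_smul, mul_assoc] using hab.mul_left ‖k‖
    · simpa [smul_comm k] using (hT x).const_smul k

variable {H} [CompleteSpace H]

/-- The trace `tr T = ∑ₑ ⟪e, T e⟫` over an orthonormal basis; the value does not depend on the
basis when `T` is trace class. -/
def trace (T : H →L[ℂ] H) : ℂ :=
  ∑' i, ⟪(exists_hilbertBasis ℂ H).choose_spec.choose i,
    T ((exists_hilbertBasis ℂ H).choose_spec.choose i)⟫_ℂ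

/-- Complete positivity of a linear map `Φ` on the trace-class operators: for every `n`, every
positive `n × n` operator matrix with trace-class entries is mapped entrywise to a positive one. -/
def IsCompletelyPositive (Φ : traceClass H →ₗ[ℂ] traceClass H) : Prop :=
  ∀ (n : ℕ) (T : Fin n → Fin n → traceClass H),
    (∀ v : Fin n → H, 0 ≤ ∑ i, ∑ j, ⟪v i, (T i j : H →L[ℂ] H) (v j)⟫_ℂ) →
    ∀ v : Fin n → H, 0 ≤ ∑ i, ∑ j, ⟪v i, (Φ (T i j) : H →L[ℂ] H) (v j)⟫_ℂ

/-- `D = Φ^*(B)` for the dual (Heisenberg) map `Φ^*` of `Φ`, i.e. `tr (D T) = tr (B Φ(T))` for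
every trace-class `T`. -/
def IsDualValue (Φ : traceClass H →ₗ[ℂ] traceClass H) (B D : H →L[ℂ] H) : Prop :=
  ∀ T : traceClass H, trace (D ∘L (T : H →L[ℂ] H)) = trace (B ∘L (Φ T : H →L[ℂ] H))

end TraceClass

/-! ## Observables and instruments

Set functions on a σ-algebra are represented by functions on all sets; only their values on
measurable sets matter. -/

section Devices

variable {Ω : Type u} [MeasurableSpace Ω] {H : Type v} [NormedAddCommGroup H]
  [InnerProductSpace ℂ H] [CompleteSpace H]

/-- Observables: normalized positive operator valued measures. -/
structure IsPOVM (M : Set Ω → H →L[ℂ] H) : Prop where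
  positive : ∀ X, MeasurableSet X → (M X).IsPositive
  normalized : M Set.univ = ContinuousLinearMap.id ℂ H
  sigmaAdditive : ∀ X : ℕ → Set Ω, (∀ i, MeasurableSet (X i)) →
    Pairwise (fun i j => Disjoint (X i) (X j)) →
    ∀ φ ψ : H, HasSum (fun i => ⟪φ, M (X i) ψ⟫_ℂ) ⟪φ, M (⋃ i, X i) ψ⟫_ℂ

/-- Sharp observables: normalized projection valued measures. -/
structure IsPVM (P : Set Ω → H →L[ℂ] H) : Prop extends IsPOVM P where
  projection : ∀ X, MeasurableSet X → IsStarProjection (P X)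

/-- (Schrödinger) instruments: completely positive, σ-additive and with trace-preserving total
map. In particular each `I X` is trace non-increasing, hence bounded for the trace norm. -/
structure IsInstrument (I : Set Ω → traceClass H →ₗ[ℂ] traceClass H) : Prop where
  completelyPositive : ∀ X, MeasurableSet X → IsCompletelyPositive (I X)
  tracePreserving : ∀ T : traceClass H,
    trace (I Set.univ T : H →L[ℂ] H) = trace (T : H →L[ℂ] H)
  sigmaAdditive : ∀ X : ℕ → Set Ω, (∀ i, MeasurableSet (X i)) →
    Pairwise (fun i j => Disjoint (X i) (X j)) →
    ∀ (B : H →L[ℂ] H) (T : traceClass H),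
      HasSum (fun i => trace (B ∘L (I (X i) T : H →L[ℂ] H)))
        (trace (B ∘L (I (⋃ i, X i) T : H →L[ℂ] H)))

/-- The observable `M` is associated to the instrument `I`: `tr (M(X) ρ) = tr (I(X)(ρ))` for every
state `ρ`. -/
def IsAssociated (I : Set Ω → traceClass H →ₗ[ℂ] traceClass H) (M : Set Ω → H →L[ℂ] H) : Prop :=
  ∀ X, MeasurableSet X → ∀ ρ : traceClass H, (ρ : H →L[ℂ] H).IsPositive →
    trace (ρ : H →L[ℂ] H) = 1 →
    trace (M X ∘L (ρ : H →L[ℂ] H)) = trace (I X ρ : H →L[ℂ] H)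

end Devices

/-! ## Hilbert space tensor products -/

section Tensor

variable (H : Type v) [NormedAddCommGroup H] [InnerProductSpace ℂ H]
  (K : Type w) [NormedAddCommGroup K] [InnerProductSpace ℂ K]

/-- The Hilbert space tensor product: the completion of the algebraic one. -/
abbrev HTensor : Type (max v w) := UniformSpace.Completion (H ⊗[ℂ] K)

variable {H K}

/-- The simple tensor `ψ ⊗ ξ`. -/
def tmul (ψ : H) (ξ : K) : HTensor H K := ((ψ ⊗ₜ[ℂ] ξ : H ⊗[ℂ] K) : HTensor H K)

variable (H) in
/-- The operator `Y_ξ : ψ ↦ ψ ⊗ ξ`. -/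
def tmulRight (ξ : K) : H →L[ℂ] HTensor H K :=
  UniformSpace.Completion.toComplL ∘L (TensorProduct.mkL ℂ H K).flip ξ

theorem tmulRight_apply (ξ : K) (ψ : H) : tmulRight H ξ ψ = tmul ψ ξ := rfl

variable {H' : Type*} [NormedAddCommGroup H'] [InnerProductSpace ℂ H']
  {K' : Type*} [NormedAddCommGroup K'] [InnerProductSpace ℂ K']

/-- The operator `B ⊗ A` on Hilbert space tensor products. -/
def tmap (B : H →L[ℂ] H') (A : K →L[ℂ] K') : HTensor H K →L[ℂ] HTensor H' K' :=
  (TensorProduct.mapL B A).completion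

theorem tmap_tmul (B : H →L[ℂ] H') (A : K →L[ℂ] K') (ψ : H) (ξ : K) :
    tmap B A (tmul ψ ξ) = tmul (B ψ) (A ξ) :=
  UniformSpace.Completion.map_coe (TensorProduct.mapL B A).uniformContinuous _

end Tensor

/-! ## Dilations and normal measurement models -/

section Models

variable {Ω : Type u} [MeasurableSpace Ω] {H : Type v} [NormedAddCommGroup H]
  [InnerProductSpace ℂ H] [CompleteSpace H]
  {K : Type w} [NormedAddCommGroup K] [InnerProductSpace ℂ K] [CompleteSpace K]

/-- `(K, P, J)` is a minimal Naimark dilation of the observable `M`. -/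
structure IsMinimalNaimark (M : Set Ω → H →L[ℂ] H) (P : Set Ω → K →L[ℂ] K)
    (J : H →ₗᵢ[ℂ] K) : Prop where
  pvm : IsPVM P
  dilates : ∀ X, MeasurableSet X → M X =
    ContinuousLinearMap.adjoint J.toContinuousLinearMap ∘L P X ∘L J.toContinuousLinearMap
  minimal : Dense (Submodule.span ℂ
    {x : K | ∃ X, MeasurableSet X ∧ ∃ ψ : H, x = P X (J ψ)} : Set K)

/-- `(K, P, Y)` is a Stinespring dilation of the instrument `I`:
`I^*(X)(B) = Y^* (B ⊗ P(X)) Y`. -/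
structure IsStinespring (I : Set Ω → traceClass H →ₗ[ℂ] traceClass H) (P : Set Ω → K →L[ℂ] K)
    (Y : H →ₗᵢ[ℂ] HTensor H K) : Prop where
  pvm : IsPVM P
  dilates : ∀ X, MeasurableSet X → ∀ B : H →L[ℂ] H, IsDualValue (I X) B
    (ContinuousLinearMap.adjoint Y.toContinuousLinearMap ∘L tmap B (P X) ∘L
      Y.toContinuousLinearMap)

/-- The vectors `(B ⊗ P(X)) Y ψ` span a dense subspace of `H ⊗ K`. -/
def IsMinimalPair (P : Set Ω → K →L[ℂ] K) (Y : H → HTensor H K) : Prop :=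
  Dense (Submodule.span ℂ {x : HTensor H K | ∃ (B : H →L[ℂ] H) (X : Set Ω) (ψ : H),
    MeasurableSet X ∧ x = tmap B (P X) (Y ψ)} : Set (HTensor H K))

/-- `(K, P, Y)` is a minimal Stinespring dilation of the instrument `I`. -/
structure IsMinimalStinespring (I : Set Ω → traceClass H →ₗ[ℂ] traceClass H)
    (P : Set Ω → K →L[ℂ] K) (Y : H →ₗᵢ[ℂ] HTensor H K) : Prop extends IsStinespring I P Y where
  minimal : IsMinimalPair P Y

/-- The normal measurement model `(K, P, U, ξ)` (`P` sharp, `U` unitary, `ξ` a unit vector)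
realizes the instrument `I`: `I^*(X)(B) = Y_ξ^* U^* (B ⊗ P(X)) U Y_ξ`. -/
structure IsNormalRealization (I : Set Ω → traceClass H →ₗ[ℂ] traceClass H)
    (P : Set Ω → K →L[ℂ] K) (U : HTensor H K ≃ₗᵢ[ℂ] HTensor H K) (ξ : K) : Prop where
  pvm : IsPVM P
  unit : ‖ξ‖ = 1
  realizes : ∀ X, MeasurableSet X → ∀ B : H →L[ℂ] H, IsDualValue (I X) B
    (ContinuousLinearMap.adjoint (tmulRight H ξ) ∘L
      ContinuousLinearMap.adjoint (U.toContinuousLinearEquiv : HTensor H K →L[ℂ] HTensor H K) ∘L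
      tmap B (P X) ∘L
      (U.toContinuousLinearEquiv : HTensor H K →L[ℂ] HTensor H K) ∘L
      tmulRight H ξ)

/-- `(K, P, U, ξ)` is a minimal normal measurement realization of `I`: it realizes `I`, the
Stinespring dilation `(K, P, U Y_ξ)` it defines is minimal, and its apparatus space embeds
isometrically, compatibly with the pointers and the interactions, into the apparatus space of
every normal measurement realization of `I`; in particular its dimension is the least possible. -/
structure IsMinimalNormalRealization (I : Set Ω → traceClass H →ₗ[ℂ] traceClass H)
    (P : Set Ω → K →L[ℂ] K) (U : HTensor H K ≃ₗᵢ[ℂ] HTensor H K) (ξ : K) : Prop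
    extends IsNormalRealization I P U ξ where
  minimalDilation : IsMinimalPair P (fun ψ : H => U (tmul ψ ξ))
  embeds : ∀ (K' : Type t) [NormedAddCommGroup K'] [InnerProductSpace ℂ K'] [CompleteSpace K']
    (P' : Set Ω → K' →L[ℂ] K') (U' : HTensor H K' ≃ₗᵢ[ℂ] HTensor H K') (ξ' : K'),
    IsNormalRealization I P' U' ξ' →
    ∃ W : K →ₗᵢ[ℂ] K',
      (∀ X, MeasurableSet X → ∀ x : K, W (P X x) = P' X (W x)) ∧
      ∀ ψ : H, tmap (ContinuousLinearMap.id ℂ H) W.toContinuousLinearMap (U (tmul ψ ξ)) =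
        U' (tmul ψ ξ')

end Models

/-! ## Direct integral Hilbert spaces -/

section DirectIntegral

variable {Ω : Type u} [MeasurableSpace Ω]

/-- The sequence space `ℓ²(ℕ)`; its subspace `{v | v k = 0 for all k ≥ n}` is the standard
`n`-dimensional Hilbert space `H_n`, for `n = 0, 1, 2, …, ∞`. -/
abbrev Seq : Type := lp (fun _ : ℕ => ℂ) 2

/-- The elements of the direct integral `∫^⊕ H_{m(x)} dμ(x)`: the square-integrable fields
`f : Ω → ℓ²(ℕ)` (modulo `μ`-null sets) with `f(x) ∈ H_{m(x)}` for `μ`-almost all `x`. -/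
def directIntegral (μ : Measure Ω) (m : Ω → ℕ∞) : Submodule ℂ (Lp Seq 2 μ) where
  carrier := {f | ∀ᵐ x ∂μ, ∀ k : ℕ, m x ≤ (k : ℕ∞) → (f x : ℕ → ℂ) k = 0}
  zero_mem' := by
    filter_upwards [Lp.coeFn_zero Seq 2 μ] with x hx k _
    rw [hx]; rfl
  add_mem' := by
    intro f g hf hg
    filter_upwards [hf, hg, Lp.coeFn_add f g] with x h1 h2 h3 k hk
    rw [h3, Pi.add_apply, lp.coeFn_add, Pi.add_apply, h1 k hk, h2 k hk, add_zero]
  smul_mem' := by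
    intro c f hf
    filter_upwards [hf, Lp.coeFn_smul c f] with x h1 h3 k hk
    rw [h3, Pi.smul_apply, lp.coeFn_smul, Pi.smul_apply, h1 k hk, smul_zero]

/-- The direct integral Hilbert space `∫^⊕ H_{m(x)} dμ(x)`. -/
abbrev DirectIntegral (μ : Measure Ω) (m : Ω → ℕ∞) : Type u := directIntegral μ m

theorem isClosed_directIntegral (μ : Measure Ω) (m : Ω → ℕ∞) :
    IsClosed (directIntegral μ m : Set (Lp Seq 2 μ)) := by
  refine IsSeqClosed.isClosed fun f g hf hfg => ?_
  obtain ⟨s, -, hs⟩ := (tendstoInMeasure_of_tendsto_Lp hfg).exists_seq_tendsto_ae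
  have hall : ∀ᵐ x ∂μ, ∀ n, ∀ k : ℕ, m x ≤ (k : ℕ∞) → (f n x : ℕ → ℂ) k = 0 :=
    ae_all_iff.2 fun n => hf n
  show ∀ᵐ x ∂μ, ∀ k : ℕ, m x ≤ (k : ℕ∞) → (g x : ℕ → ℂ) k = 0
  filter_upwards [hall, hs] with x h1 h2 k hk
  have h3 : Filter.Tendsto (fun n => (f (s n) x : ℕ → ℂ) k) Filter.atTop
      (nhds ((g x : ℕ → ℂ) k)) :=
    ((continuous_apply k).comp
      (lp.uniformContinuous_coe (E := fun _ : ℕ => ℂ) (p := 2)).continuous).continuousAt.tendsto.comp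
      h2
  exact tendsto_nhds_unique h3 (by simp [h1 _ k hk])

instance (μ : Measure Ω) (m : Ω → ℕ∞) : CompleteSpace (DirectIntegral μ m) :=
  (isClosed_directIntegral μ m).completeSpace_coe

/-- Multiplication by the characteristic function of a measurable set, on the direct integral. -/
def mulIndicator (μ : Measure Ω) (m : Ω → ℕ∞) {X : Set Ω} (hX : MeasurableSet X) :
    DirectIntegral μ m →L[ℂ] DirectIntegral μ m :=
  LinearMap.mkContinuous
    { toFun := fun f => ⟨((Lp.memLp f.1).indicator hX).toLp _, by
        have hf : ∀ᵐ x ∂μ, ∀ k : ℕ, m x ≤ (k : ℕ∞) → (f.1 x : ℕ → ℂ) k = 0 := f.2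
        change ∀ᵐ x ∂μ, ∀ k : ℕ, m x ≤ (k : ℕ∞) → _
        filter_upwards [hf, ((Lp.memLp f.1).indicator hX).coeFn_toLp] with x h1 h2 k hk
        rw [h2]
        by_cases hx : x ∈ X
        · rw [Set.indicator_of_mem hx]; exact h1 k hk
        · rw [Set.indicator_of_notMem hx]; rfl⟩
      map_add' := fun f g => by
        apply Subtype.ext
        change ((Lp.memLp (f + g).1).indicator hX).toLp _ =
          ((Lp.memLp f.1).indicator hX).toLp _ + ((Lp.memLp g.1).indicator hX).toLp _
        rw [← MemLp.toLp_add, MemLp.toLp_eq_toLp_iff]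
        filter_upwards [Lp.coeFn_add f.1 g.1] with x hx
        by_cases h : x ∈ X
        · simpa [Set.indicator_of_mem h] using hx
        · simp [Set.indicator_of_notMem h]
      map_smul' := fun c f => by
        apply Subtype.ext
        change ((Lp.memLp (c • f).1).indicator hX).toLp _ =
          c • ((Lp.memLp f.1).indicator hX).toLp _
        rw [← MemLp.toLp_const_smul, MemLp.toLp_eq_toLp_iff]
        filter_upwards [Lp.coeFn_smul c f.1] with x hx
        by_cases h : x ∈ X
        · simpa [Set.indicator_of_mem h] using hx
        · simp [Set.indicator_of_notMem h] }
    1 (fun f => by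
      rw [one_mul]
      change ‖((Lp.memLp f.1).indicator hX).toLp _‖ ≤ ‖f.1‖
      refine Lp.norm_le_norm_of_ae_le ?_
      filter_upwards [((Lp.memLp f.1).indicator hX).coeFn_toLp] with x hx
      rw [hx]
      exact norm_indicator_le_norm_self _ _)

theorem mulIndicator_coeFn (μ : Measure Ω) (m : Ω → ℕ∞) {X : Set Ω} (hX : MeasurableSet X)
    (f : DirectIntegral μ m) :
    ((mulIndicator μ m hX f).1 : Ω → Seq) =ᵐ[μ] X.indicator (f.1 : Ω → Seq) :=
  ((Lp.memLp f.1).indicator hX).coeFn_toLp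

open Classical in
/-- The canonical spectral measure of `∫^⊕ H_{m(x)} dμ(x)`: to a measurable set `X` corresponds
the multiplication by its characteristic function. -/
def canonicalPVM (μ : Measure Ω) (m : Ω → ℕ∞) (X : Set Ω) :
    DirectIntegral μ m →L[ℂ] DirectIntegral μ m :=
  if hX : MeasurableSet X then mulIndicator μ m hX else 0

variable {H : Type v} [NormedAddCommGroup H] [InnerProductSpace ℂ H] [CompleteSpace H]

/-- `μ` and the observable `M` are mutually absolutely continuous. -/
def MutuallyAC (μ : Measure Ω) (M : Set Ω → H →L[ℂ] H) : Prop :=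
  ∀ X, MeasurableSet X → (μ X = 0 ↔ M X = 0)

/-- The observable `M` is rank-`∞`: the multiplicity function `m` of a minimal Naimark dilation of
`M` into a direct integral `∫^⊕ H_{m(x)} dμ(x)` with its canonical spectral measure is infinite
`μ`-almost everywhere. (For separable `H` such a dilation exists, and its function `m` is unique
up to `μ`-null sets.) -/
def IsRankInfinite (μ : Measure Ω) (M : Set Ω → H →L[ℂ] H) : Prop :=
  ∀ (m : Ω → ℕ∞), Measurable m → ∀ J : H →ₗᵢ[ℂ] DirectIntegral μ m,
    IsMinimalNaimark M (canonicalPVM μ m) J → ∀ᵐ x ∂μ, m x = ⊤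

end DirectIntegral

/-! ## Adding one dimension and a null outcome

The extended outcome space `Ω ∪ {x₀}` is `Option Ω`, with `x₀ = none`. -/

section Extended

variable {Ω : Type u} [MeasurableSpace Ω]

/-- The smallest σ-algebra of `Ω ∪ {x₀}` containing the measurable subsets of `Ω`. -/
instance extendedMeasurableSpace : MeasurableSpace (Option Ω) :=
  MeasurableSpace.generateFrom {S | ∃ X : Set Ω, MeasurableSet X ∧ S = some '' X}

theorem measurableSet_extended_iff (S : Set (Option Ω)) :
    MeasurableSet S ↔ MeasurableSet (some ⁻¹' S) := by
  have hsome : ∀ X : Set Ω, MeasurableSet X → MeasurableSet (some '' X) := fun X hX =>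
    MeasurableSpace.measurableSet_generateFrom ⟨X, hX, rfl⟩
  constructor
  · intro hS
    have hle : extendedMeasurableSpace ≤ MeasurableSpace.map (some : Ω → Option Ω) inferInstance :=
      MeasurableSpace.generateFrom_le (by
        rintro _ ⟨X, hX, rfl⟩
        show MeasurableSet (some ⁻¹' (some '' X))
        rwa [Set.preimage_image_eq X (Option.some_injective Ω)])
    exact hle S hS
  · intro hS
    by_cases h : none ∈ S
    · have h1 : S = (some '' (some ⁻¹' S)ᶜ)ᶜ := by
        ext (_ | x) <;> simp [h]
      rw [h1]
      exact (hsome _ hS.compl).compl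
    · have h1 : S = some '' (some ⁻¹' S) := by
        ext (_ | x) <;> simp [h]
      rw [h1]
      exact hsome _ hS

variable {H : Type v} [NormedAddCommGroup H] [InnerProductSpace ℂ H]
  {K : Type w} [NormedAddCommGroup K] [InnerProductSpace ℂ K]

/-- The extended instrument `I₊`: `I₊(X) = I₊(X ∪ {x₀}) = I(X)` for measurable `X ⊆ Ω`. -/
def extendInstrument (I : Set Ω → traceClass H →ₗ[ℂ] traceClass H) :
    Set (Option Ω) → traceClass H →ₗ[ℂ] traceClass H :=
  fun S => I (some ⁻¹' S)

variable (K) in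
/-- The Hilbert space `K ⊕ ℂ`. -/
abbrev Extend : Type w := WithLp 2 (K × ℂ)

variable (K) in
/-- The embedding `x ↦ (x, 0)` of `K` into `K ⊕ ℂ`. -/
def inExtend : K →L[ℂ] Extend K :=
  ((WithLp.prodContinuousLinearEquiv 2 ℂ K ℂ).symm : K × ℂ →L[ℂ] Extend K) ∘L
    ContinuousLinearMap.inl ℂ K ℂ

open Classical in
/-- The extended pointer `P₊`, determined by `P₊(X)(x, c) = (P(X) x, 0)` for measurable `X ⊆ Ω`
and `P₊({x₀})(x, c) = (0, c)`. -/
def extendPointer (P : Set Ω → K →L[ℂ] K) : Set (Option Ω) → Extend K →L[ℂ] Extend K :=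
  fun S =>
    ((WithLp.prodContinuousLinearEquiv 2 ℂ K ℂ).symm : K × ℂ →L[ℂ] Extend K) ∘L
      ((P (some ⁻¹' S)).prodMap
        (if none ∈ S then ContinuousLinearMap.id ℂ ℂ else 0)) ∘L
      ((WithLp.prodContinuousLinearEquiv 2 ℂ K ℂ) : Extend K →L[ℂ] K × ℂ)

/-- `Y₊ ψ = (Y ψ, 0)`, as a map into `H ⊗ (K ⊕ ℂ) ≅ (H ⊗ K) ⊕ H`. -/
def extendIsometry (Y : H →ₗᵢ[ℂ] HTensor H K) : H →L[ℂ] HTensor H (Extend K) :=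
  tmap (ContinuousLinearMap.id ℂ H) (inExtend K) ∘L Y.toContinuousLinearMap

end Extended

end QMeas

end

open QMeas

/-! A unitary with `U (ψ ⊗ ξ) = Y ψ` exists as soon as the complements of `H ⊗ ξ` and of `Y H` in `H
⊗ K` have equal dimension. If `dim H` is finite, it cancels from `dim H + codim = dim (H ⊗ K)`. If
`H` is infinite dimensional and separable, it suffices that both complements are infinite
dimensional, because each then has the dimension of the whole space (`exists_unitary_comp_eq`).

For case (i) with `dim H = ∞`, choose a finite `n` such that the multiplicity `m` of the minimal
Naimark dilation equals `n` on a nonnull set `A`. That dilation embeds by some `Z` into `H ⊗ K`,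
with range containing `Y H`. Take `f ≠ 0` with `P(A) f = f`. If `Y H` had finite codimension, then
`h ⊗ f` would lie in the range of `Z` for all `h` in an infinite dimensional subspace. Pulling back
`n + 1` orthonormal such `h` gives sections of the direct integral that are pointwise orthogonal and
of equal length. In the `n`-dimensional fibres over `A` they must vanish, which contradicts `P(A) f
= f ≠ 0`. The same fibre count shows that `K` is not spanned by `ξ`: otherwise every `M(X)` would be
a scalar. A vector orthogonal to `ξ` then makes the complement of `H ⊗ ξ` infinite dimensional.

In case (ii)(b) the added dimension places a copy of `H` in the complement of `Y₊ H`, and `K ⊕ ℂ`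
has dimension at least two, so no fibre count is needed. The compression of `B ⊗ P₊` by `Y₊` is that
of `B ⊗ P` by `Y`.

Minimality is independent of rank: the Gram matrix of the vectors `(B ⊗ P(X)) Y ψ` depends only on
the instrument, so a minimal dilation embeds isometrically in any other, and commutation with all `B
⊗ 1` gives the embedding the form `1 ⊗ W` (`exists_intertwiner`). -/

namespace QMeas

/-! ### Calculus of simple tensors and of operators `B ⊗ A`. -/

section TensorLemmas

variable {H : Type*} [NormedAddCommGroup H] [InnerProductSpace ℂ H]
  {K : Type*} [NormedAddCommGroup K] [InnerProductSpace ℂ K]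
  {H' : Type*} [NormedAddCommGroup H'] [InnerProductSpace ℂ H']
  {K' : Type*} [NormedAddCommGroup K'] [InnerProductSpace ℂ K']
  {H'' : Type*} [NormedAddCommGroup H''] [InnerProductSpace ℂ H'']
  {K'' : Type*} [NormedAddCommGroup K''] [InnerProductSpace ℂ K'']

theorem inner_tmul (a c : H) (b d : K) : ⟪tmul a b, tmul c d⟫_ℂ = ⟪a, c⟫_ℂ * ⟪b, d⟫_ℂ := by
  simp [tmul, UniformSpace.Completion.inner_coe, TensorProduct.inner_tmul]

theorem norm_tmul (a : H) (b : K) : ‖tmul a b‖ = ‖a‖ * ‖b‖ := by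
  simp [tmul, UniformSpace.Completion.norm_coe]

theorem continuousLinearMap_ext_tmul {G : Type*} [NormedAddCommGroup G] [NormedSpace ℂ G]
    {S T : HTensor H K →L[ℂ] G} (h : ∀ a b, S (tmul a b) = T (tmul a b)) : S = T := by
  ext x
  induction x using UniformSpace.Completion.induction_on with
  | hp => exact isClosed_eq S.continuous T.continuous
  | ih z =>
    induction z using TensorProduct.induction_on with
    | zero => rw [UniformSpace.Completion.coe_zero, map_zero, map_zero]
    | tmul a b => exact h a b
    | add y z hy hz => rw [UniformSpace.Completion.coe_add, map_add, map_add, hy, hz]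

theorem tmap_comp (B : H' →L[ℂ] H'') (A : K' →L[ℂ] K'') (D : H →L[ℂ] H') (C : K →L[ℂ] K') :
    tmap B A ∘L tmap D C = tmap (B ∘L D) (A ∘L C) :=
  continuousLinearMap_ext_tmul fun a b => by simp [tmap_tmul]

theorem tmap_tmap (B : H' →L[ℂ] H'') (A : K' →L[ℂ] K'') (D : H →L[ℂ] H') (C : K →L[ℂ] K')
    (x : HTensor H K) : tmap B A (tmap D C x) = tmap (B ∘L D) (A ∘L C) x := by
  rw [← tmap_comp]; rfl

theorem tmap_id_id : tmap (ContinuousLinearMap.id ℂ H) (ContinuousLinearMap.id ℂ K) =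
    ContinuousLinearMap.id ℂ _ :=
  continuousLinearMap_ext_tmul fun a b => by simp [tmap_tmul]

theorem adjoint_tmap [CompleteSpace H] [CompleteSpace K] [CompleteSpace H'] [CompleteSpace K']
    (B : H →L[ℂ] H') (A : K →L[ℂ] K') :
    ContinuousLinearMap.adjoint (tmap B A) =
      tmap (ContinuousLinearMap.adjoint B) (ContinuousLinearMap.adjoint A) := by
  refine continuousLinearMap_ext_tmul fun a b => ?_
  refine ext_inner_right ℂ fun y => ?_
  rw [ContinuousLinearMap.adjoint_inner_left]
  have : (innerSL ℂ (tmul a b)) ∘L tmap B A =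
      innerSL ℂ (tmap (ContinuousLinearMap.adjoint B) (ContinuousLinearMap.adjoint A)
        (tmul a b)) :=
    continuousLinearMap_ext_tmul fun c d => by
      simp [tmap_tmul, inner_tmul, ContinuousLinearMap.adjoint_inner_left]
  exact DFunLike.congr_fun this y

variable (K) in
/-- The operator `ξ ↦ ψ ⊗ ξ`. -/
noncomputable def tmulLeft (ψ : H) : K →L[ℂ] HTensor H K :=
  UniformSpace.Completion.toComplL ∘L TensorProduct.mkL ℂ H K ψ

theorem tmulLeft_apply (ψ : H) (ξ : K) : tmulLeft K ψ ξ = tmul ψ ξ := rfl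

end TensorLemmas

/-! ### Rank-one operators as test operators for the trace. -/

section TraceLemmas

variable {H : Type*} [NormedAddCommGroup H] [InnerProductSpace ℂ H]

/-- The rank-one operator `|a⟩⟨b|`. -/
noncomputable def rankOne (a b : H) : H →L[ℂ] H := (innerSL ℂ b).smulRight a

theorem rankOne_apply (a b x : H) : rankOne a b x = ⟪b, x⟫_ℂ • a := rfl

theorem rankOne_mem_traceClass (a b : H) : rankOne a b ∈ traceClass H := by
  refine ⟨fun n => if n = 0 then a else 0, fun n => if n = 0 then b else 0, ?_, fun x => ?_⟩
  · refine summable_of_ne_finset_zero (s := {0}) fun n hn => ?_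
    simp at hn; simp [hn]
  · have := hasSum_single (f := fun n : ℕ => ⟪if n = 0 then b else 0, x⟫_ℂ •
      (if n = 0 then a else (0 : H))) 0 fun n hn => by simp [hn]
    simpa [rankOne_apply] using this

theorem comp_rankOne (D : H →L[ℂ] H) (a b : H) : D ∘L rankOne a b = rankOne (D a) b := by
  ext x; simp [rankOne_apply]

theorem rankOne_self_isPositive (a : H) : (rankOne a a).IsPositive := by
  rw [ContinuousLinearMap.isPositive_iff_complex]
  intro x
  rw [rankOne_apply, inner_smul_left, RCLike.conj_mul]
  norm_cast
  exact ⟨rfl, sq_nonneg _⟩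

variable [CompleteSpace H]

theorem trace_rankOne (a b : H) : trace (rankOne a b) = ⟪b, a⟫_ℂ := by
  unfold trace
  simp only [rankOne_apply, inner_smul_right]
  exact HilbertBasis.tsum_inner_mul_inner _ b a

theorem rankOne_comp (a b : H) (T : H →L[ℂ] H) :
    rankOne a b ∘L T = rankOne a (ContinuousLinearMap.adjoint T b) := by
  ext x; simp [rankOne_apply, ContinuousLinearMap.adjoint_inner_left]

/-- Testing on `T = |a⟩⟨b|` gives `tr (D T) = ⟪b, D a⟫`, so all matrix elements of `D` are fixed.
This lets different dilations of one instrument be compared. -/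
theorem IsDualValue.unique {Φ : traceClass H →ₗ[ℂ] traceClass H} {B D D' : H →L[ℂ] H}
    (h : IsDualValue Φ B D) (h' : IsDualValue Φ B D') : D = D' := by
  ext a
  refine ext_inner_left ℂ fun b => ?_
  have := (h ⟨_, rankOne_mem_traceClass a b⟩).trans (h' ⟨_, rankOne_mem_traceClass a b⟩).symm
  simpa only [comp_rankOne, trace_rankOne] using this

theorem eq_zero_of_trace_comp_eq_zero {T : H →L[ℂ] H}
    (h : ∀ B : H →L[ℂ] H, trace (B ∘L T) = 0) : T = 0 := by
  ext a
  refine ext_inner_left ℂ fun b => ?_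
  have := h (rankOne a b)
  rw [rankOne_comp, trace_rankOne, ContinuousLinearMap.adjoint_inner_left] at this
  simpa using this

end TraceLemmas

/-! ### Additivity and multiplicativity of projection valued measures. -/

section POVMLemmas

variable {Ω : Type*} [MeasurableSpace Ω] {K : Type*} [NormedAddCommGroup K]
  [InnerProductSpace ℂ K] {P : Set Ω → K →L[ℂ] K}

/-- Applied to the constant sequence `∅`, σ-additivity makes a constant family over `ℕ` summable. -/
theorem IsPOVM.empty (hP : IsPOVM P) : P ∅ = 0 := by
  ext a
  refine ext_inner_left ℂ fun b => ?_
  have h := hP.sigmaAdditive (fun _ => ∅) (fun _ => .empty) (fun i j _ => disjoint_bot_left) b a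
  simpa using (summable_const_iff _).1 h.summable

theorem IsPOVM.union (hP : IsPOVM P) {X Z : Set Ω} (hX : MeasurableSet X) (hZ : MeasurableSet Z)
    (hd : Disjoint X Z) : P (X ∪ Z) = P X + P Z := by
  ext a
  refine ext_inner_left ℂ fun b => ?_
  let F : ℕ → Set Ω := fun n => if n = 0 then X else if n = 1 then Z else ∅
  have hF : ⋃ n, F n = X ∪ Z := by
    ext x
    simp only [Set.mem_iUnion, Set.mem_union]
    constructor
    · rintro ⟨n, hn⟩
      simp only [F] at hn
      split_ifs at hn <;> simp_all
    · rintro (h | h)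
      · exact ⟨0, by simpa [F]⟩
      · exact ⟨1, by simpa [F]⟩
  have h := hP.sigmaAdditive F (fun i => by simp only [F]; split_ifs <;> simp [hX, hZ])
    (fun i j hij => by
      simp only [F]
      split_ifs <;> first | omega | exact hd | exact hd.symm | simp) b a
  rw [hF] at h
  have h2 : HasSum (fun i => ⟪b, P (F i) a⟫_ℂ) (∑ i ∈ Finset.range 2, ⟪b, P (F i) a⟫_ℂ) :=
    hasSum_sum_of_ne_finset_zero fun n hn => by
      have : n ≠ 0 ∧ n ≠ 1 := by simp at hn; omega
      simp [F, this.1, this.2, hP.empty]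
  rw [h.unique h2]
  simp [Finset.sum_range_succ, F, inner_add_right]

variable [CompleteSpace K]

/-- As `P X + P Z` is idempotent, the two projections anticommute. Multiplying that relation by `P
X` on either side shows that they also commute, hence `2 P X P Z = 0`. -/
theorem IsPVM.mul_of_disjoint (hP : IsPVM P) {X Z : Set Ω} (hX : MeasurableSet X)
    (hZ : MeasurableSet Z) (hd : Disjoint X Z) : P X * P Z = 0 := by
  have h1 := (hP.projection X hX).isIdempotentElem
  have h2 := (hP.projection Z hZ).isIdempotentElem
  have h3 := (hP.projection _ (hX.union hZ)).isIdempotentElem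
  rw [hP.union hX hZ hd] at h3
  have h3' : (P X + P Z) * (P X + P Z) = P X + P Z := h3
  rw [mul_add, add_mul, add_mul, h1.eq, h2.eq] at h3'
  have h4 : P X * P Z + P Z * P X = 0 := by
    rw [← sub_eq_zero.2 h3']
    abel
  have h5 : P X * P Z + P X * P Z * P X = 0 := by
    have := congrArg (P X * ·) h4
    simpa only [mul_add, ← mul_assoc, h1.eq, mul_zero] using this
  have h6 : P X * P Z * P X + P Z * P X = 0 := by
    have := congrArg (· * P X) h4
    simpa only [add_mul, mul_assoc, h1.eq, zero_mul] using this
  have h7 : P X * P Z = P Z * P X :=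
    (eq_neg_of_add_eq_zero_left h5).trans (neg_eq_of_add_eq_zero_right h6)
  rw [← h7, ← two_smul ℂ] at h4
  exact (smul_eq_zero.1 h4).resolve_left two_ne_zero

theorem IsPVM.mul (hP : IsPVM P) {X Z : Set Ω} (hX : MeasurableSet X)
    (hZ : MeasurableSet Z) : P X * P Z = P (X ∩ Z) := by
  have hX' : P X = P (X ∩ Z) + P (X \ Z) := by
    rw [← hP.union (hX.inter hZ) (hX.diff hZ) Set.disjoint_sdiff_inter.symm,
      Set.inter_union_sdiff]
  have hZ' : P Z = P (X ∩ Z) + P (Z \ X) := by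
    rw [Set.inter_comm, ← hP.union (hZ.inter hX) (hZ.diff hX) Set.disjoint_sdiff_inter.symm,
      Set.inter_union_sdiff]
  rw [hX', hZ', add_mul, mul_add, mul_add,
    hP.mul_of_disjoint (hX.inter hZ) (hZ.diff hX)
      (Set.disjoint_left.2 fun x h h' => h'.2 h.1),
    hP.mul_of_disjoint (hX.diff hZ) (hX.inter hZ)
      (Set.disjoint_left.2 fun x h h' => h.2 h'.2),
    hP.mul_of_disjoint (hX.diff hZ) (hZ.diff hX)
      (Set.disjoint_left.2 fun x h h' => h.2 h'.1)]
  simpa using (hP.projection _ (hX.inter hZ)).isIdempotentElem.eq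

theorem IsPVM.adjoint (hP : IsPVM P) {X : Set Ω} (hX : MeasurableSet X) :
    ContinuousLinearMap.adjoint (P X) = P X :=
  (hP.projection X hX).isSelfAdjoint

theorem IsPVM.comp_adjoint (hP : IsPVM P) {X Z : Set Ω} (hX : MeasurableSet X)
    (hZ : MeasurableSet Z) : ContinuousLinearMap.adjoint (P X) ∘L P Z = P (X ∩ Z) := by
  rw [hP.adjoint hX]; exact hP.mul hX hZ

end POVMLemmas

/-! ### Isometries from equal Gram matrices. -/

section Gram

variable {ι : Type*} {E : Type*} [NormedAddCommGroup E] [InnerProductSpace ℂ E]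
  {F : Type*} [NormedAddCommGroup F] [InnerProductSpace ℂ F]

theorem inner_linearCombination_of_gram (v : ι → E) (v' : ι → F)
    (h : ∀ i j, ⟪v i, v j⟫_ℂ = ⟪v' i, v' j⟫_ℂ) (c d : ι →₀ ℂ) :
    ⟪Finsupp.linearCombination ℂ v c, Finsupp.linearCombination ℂ v d⟫_ℂ =
      ⟪Finsupp.linearCombination ℂ v' c, Finsupp.linearCombination ℂ v' d⟫_ℂ := by
  simp only [Finsupp.linearCombination_apply, Finsupp.sum_inner, Finsupp.inner_sum,
    inner_smul_left, inner_smul_right, h]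

/-- Two families with the same Gram matrix, the first of them total, are related by a linear
isometry. -/
theorem exists_linearIsometry_of_gram [CompleteSpace F] (v : ι → E) (v' : ι → F)
    (hd : Dense (Submodule.span ℂ (Set.range v) : Set E))
    (h : ∀ i j, ⟪v i, v j⟫_ℂ = ⟪v' i, v' j⟫_ℂ) :
    ∃ V : E →ₗᵢ[ℂ] F, ∀ i, V (v i) = v' i := by
  set e := Finsupp.linearCombination ℂ v
  set f := Finsupp.linearCombination ℂ v'
  have hde : DenseRange e := by
    rw [← Finsupp.range_linearCombination] at hd
    exact hd
  have hn : ∀ c, ‖f c‖ = ‖e c‖ := fun c => by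
    rw [@norm_eq_sqrt_re_inner ℂ, @norm_eq_sqrt_re_inner ℂ,
      inner_linearCombination_of_gram v v' h]
  -- The norm bound makes `e c ↦ f c` well defined on the dense range of `e`, so it extends
  -- continuously.
  have hex : ∃ C, ∀ c, ‖f c‖ ≤ C * ‖e c‖ := ⟨1, fun c => by rw [one_mul, hn]⟩
  have hV : ∀ c, f.extendOfNorm e (e c) = f c := LinearMap.extendOfNorm_eq hde hex
  refine ⟨⟨(f.extendOfNorm e).toLinearMap, fun x => ?_⟩, fun i => ?_⟩
  · refine hde.induction_on x (isClosed_eq (by fun_prop) (by fun_prop)) fun c => ?_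
    change ‖f.extendOfNorm e (e c)‖ = _
    rw [hV, hn]
  · have := hV (Finsupp.single i 1)
    simpa [e, f] using this

end Gram

/-! ### Embedding a minimal Stinespring dilation. -/

section Stinespring

variable {Ω : Type*} [MeasurableSpace Ω]
  {H : Type*} [NormedAddCommGroup H] [InnerProductSpace ℂ H]
  {K : Type*} [NormedAddCommGroup K] [InnerProductSpace ℂ K]
  {K' : Type*} [NormedAddCommGroup K'] [InnerProductSpace ℂ K'] [CompleteSpace K']

theorem adjoint_tmulLeft_tmul [CompleteSpace K] (e a : H) (k : K) :
    ContinuousLinearMap.adjoint (tmulLeft K e) (tmul a k) = ⟪e, a⟫_ℂ • k := by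
  refine ext_inner_left ℂ fun y => ?_
  rw [ContinuousLinearMap.adjoint_inner_right, tmulLeft_apply, inner_tmul, inner_smul_right]

theorem tmap_rankOne [CompleteSpace K] (a e : H) :
    tmap (rankOne a e) (ContinuousLinearMap.id ℂ K) =
      tmulLeft K a ∘L ContinuousLinearMap.adjoint (tmulLeft K e) :=
  continuousLinearMap_ext_tmul fun b k => by
    simp only [tmap_tmul, ContinuousLinearMap.comp_apply, adjoint_tmulLeft_tmul, rankOne_apply,
      map_smul, tmulLeft_apply, ContinuousLinearMap.id_apply]
    exact map_smul (tmulRight H k) _ _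

/-- An isometry that commutes with all operators `B ⊗ 1` is of the form `1 ⊗ W`. -/
theorem exists_tmap_eq_of_commute [Nontrivial H] (V : HTensor H K →ₗᵢ[ℂ] HTensor H K')
    (hV : ∀ (B : H →L[ℂ] H) x, V (tmap B (ContinuousLinearMap.id ℂ K) x) =
      tmap B (ContinuousLinearMap.id ℂ K') (V x)) :
    ∃ W : K →ₗᵢ[ℂ] K', ∀ x,
      V x = tmap (ContinuousLinearMap.id ℂ H) W.toContinuousLinearMap x := by
  obtain ⟨e, he⟩ := exists_norm_eq H zero_le_one
  have he' : ⟪e, e⟫_ℂ = 1 := by rw [inner_self_eq_norm_sq_to_K, he]; simp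
  -- `W₀` is the compression of `V` to the slice `e ⊗ K`. That slice determines `V`, because `a ⊗ k
  -- = (|a⟩⟨e| ⊗ 1)(e ⊗ k)` and `V` commutes with `|a⟩⟨e| ⊗ 1`.
  let W₀ : K →L[ℂ] K' := ContinuousLinearMap.adjoint (tmulLeft K' e) ∘L
    V.toContinuousLinearMap ∘L tmulLeft K e
  have key : ∀ (a : H) (k : K), V (tmul a k) = tmul a (W₀ k) := fun a k => by
    have h1 : tmul a k = tmap (rankOne a e) (ContinuousLinearMap.id ℂ K) (tmul e k) := by
      rw [tmap_tmul, rankOne_apply, he', one_smul]; rfl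
    rw [h1, hV, tmap_rankOne]
    rfl
  refine ⟨⟨W₀.toLinearMap, fun k => ?_⟩, fun x => ?_⟩
  · have h2 : ‖V (tmul e k)‖ = ‖tmul e (W₀ k)‖ := by rw [key]
    rw [V.norm_map, norm_tmul, norm_tmul, he, one_mul, one_mul] at h2
    exact h2.symm
  · have : V.toContinuousLinearMap = tmap (ContinuousLinearMap.id ℂ H) W₀ :=
      continuousLinearMap_ext_tmul fun a k => by rw [tmap_tmul]; exact key a k
    exact DFunLike.congr_fun this x

variable [CompleteSpace H] [CompleteSpace K]

/-- Since `P(X)* P(Z) = P(X ∩ Z)`, these inner products are matrix elements of the compressions `Y*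
(C ⊗ P) Y`, which is all that a dilation shares with another one. -/
theorem inner_tmap_pvm {P : Set Ω → K →L[ℂ] K} (hP : IsPVM P) (Y : H →L[ℂ] HTensor H K)
    (B C : H →L[ℂ] H) {X Z : Set Ω} (hX : MeasurableSet X) (hZ : MeasurableSet Z) (ψ φ : H) :
    ⟪tmap B (P X) (Y ψ), tmap C (P Z) (Y φ)⟫_ℂ =
      ⟪ψ, (ContinuousLinearMap.adjoint Y ∘L
        tmap (ContinuousLinearMap.adjoint B ∘L C) (P (X ∩ Z)) ∘L Y) φ⟫_ℂ := by
  rw [← hP.comp_adjoint hX hZ, ← tmap_comp, ← adjoint_tmap]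
  simp [ContinuousLinearMap.adjoint_inner_right]

/-- A minimal Stinespring dilation embeds into every other one. -/
theorem exists_intertwiner [Nontrivial H] {P : Set Ω → K →L[ℂ] K} (hP : IsPVM P)
    {P' : Set Ω → K' →L[ℂ] K'} (hP' : IsPVM P') (Y : H →L[ℂ] HTensor H K)
    (Y' : H →L[ℂ] HTensor H K') (hmin : IsMinimalPair P Y)
    (h : ∀ X, MeasurableSet X → ∀ B : H →L[ℂ] H,
      ContinuousLinearMap.adjoint Y ∘L tmap B (P X) ∘L Y =
        ContinuousLinearMap.adjoint Y' ∘L tmap B (P' X) ∘L Y') :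
    ∃ W : K →ₗᵢ[ℂ] K', (∀ X, MeasurableSet X → ∀ x : K, W (P X x) = P' X (W x)) ∧
      ∀ ψ : H, tmap (ContinuousLinearMap.id ℂ H) W.toContinuousLinearMap (Y ψ) = Y' ψ := by
  let ι := (H →L[ℂ] H) × {X : Set Ω // MeasurableSet X} × H
  let v : ι → HTensor H K := fun i => tmap i.1 (P i.2.1.1) (Y i.2.2)
  let v' : ι → HTensor H K' := fun i => tmap i.1 (P' i.2.1.1) (Y' i.2.2)
  have hv : Dense (Submodule.span ℂ (Set.range v) : Set (HTensor H K)) := by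
    unfold IsMinimalPair at hmin
    convert hmin using 4
    ext x
    constructor
    · rintro ⟨⟨B, X, ψ⟩, rfl⟩
      exact ⟨B, X, ψ, X.2, rfl⟩
    · rintro ⟨B, X, ψ, hX, rfl⟩
      exact ⟨(B, ⟨X, hX⟩, ψ), rfl⟩
  obtain ⟨V, hV⟩ := exists_linearIsometry_of_gram v v' hv fun i j => by
    rw [inner_tmap_pvm hP Y _ _ i.2.1.2 j.2.1.2, inner_tmap_pvm hP' Y' _ _ i.2.1.2 j.2.1.2,
      h _ (i.2.1.2.inter j.2.1.2)]
  have hcomm : ∀ (B : H →L[ℂ] H) (X : Set Ω), MeasurableSet X → ∀ x,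
      V (tmap B (P X) x) = tmap B (P' X) (V x) := fun B X hX x => by
    -- It is enough to check this on the total family, which `B ⊗ P X` maps into itself: `(B ⊗ P
    -- X)(C ⊗ P Z) = BC ⊗ P(X ∩ Z)`.
    have : V.toContinuousLinearMap ∘L tmap B (P X) = tmap B (P' X) ∘L V.toContinuousLinearMap := by
      refine ContinuousLinearMap.ext_on hv ?_
      rintro _ ⟨⟨C, Z, ψ⟩, rfl⟩
      have h1 := hV (B ∘L C, ⟨X ∩ Z.1, hX.inter Z.2⟩, ψ)
      have h2 := hV (C, Z, ψ)
      simp only [v, v', ← hP.mul hX Z.2, ← hP'.mul hX Z.2, ContinuousLinearMap.mul_def,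
        ← tmap_comp, ContinuousLinearMap.comp_apply] at h1 h2
      simp only [v, ContinuousLinearMap.comp_apply, LinearIsometry.coe_toContinuousLinearMap, h1,
        h2]
    exact DFunLike.congr_fun this x
  obtain ⟨W, hW⟩ := exists_tmap_eq_of_commute V fun B x => by
    have := hcomm B Set.univ .univ x
    rwa [hP.normalized, hP'.normalized] at this
  refine ⟨W, fun X hX x => ?_, fun ψ => ?_⟩
  · obtain ⟨e, he⟩ := exists_norm_eq H zero_le_one
    have h1 := hcomm (ContinuousLinearMap.id ℂ H) X hX (tmul e x)
    rw [hW, hW, tmap_tmul, tmap_tmul, tmap_tmul, tmap_tmul] at h1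
    -- Contracting with the unit vector `e` removes the factor `H`.
    have h2 := congrArg (ContinuousLinearMap.adjoint (tmulLeft K' e)) h1
    simpa [adjoint_tmulLeft_tmul, inner_self_eq_norm_sq_to_K, he] using h2
  · have := hV (ContinuousLinearMap.id ℂ H, ⟨Set.univ, .univ⟩, ψ)
    simpa [v, v', hP.normalized, hP'.normalized, tmap_id_id, hW] using this

end Stinespring

/-! ### From dilations to normal realizations. -/

section Realization

variable {Ω : Type u} [MeasurableSpace Ω]
  {H : Type v} [NormedAddCommGroup H] [InnerProductSpace ℂ H] [CompleteSpace H]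
  {K : Type w} [NormedAddCommGroup K] [InnerProductSpace ℂ K]
  {I : Set Ω → traceClass H →ₗ[ℂ] traceClass H} {P : Set Ω → K →L[ℂ] K}

/-- `U Y_ξ` as a bounded operator. -/
noncomputable abbrev unitaryTmulRight (U : HTensor H K ≃ₗᵢ[ℂ] HTensor H K) (ξ : K) :
    H →L[ℂ] HTensor H K :=
  (U.toContinuousLinearEquiv : HTensor H K →L[ℂ] HTensor H K) ∘L tmulRight H ξ

theorem adjoint_unitaryTmulRight_comp (U : HTensor H K ≃ₗᵢ[ℂ] HTensor H K) (ξ : K)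
    (T : HTensor H K →L[ℂ] HTensor H K) :
    ContinuousLinearMap.adjoint (unitaryTmulRight U ξ) ∘L T ∘L unitaryTmulRight U ξ =
    ContinuousLinearMap.adjoint (tmulRight H ξ) ∘L
      ContinuousLinearMap.adjoint (U.toContinuousLinearEquiv : HTensor H K →L[ℂ] HTensor H K) ∘L
      T ∘L
      (U.toContinuousLinearEquiv : HTensor H K →L[ℂ] HTensor H K) ∘L
      tmulRight H ξ := by
  rw [ContinuousLinearMap.adjoint_comp]; rfl

variable [CompleteSpace K]

theorem isNormalRealization_of_dilates (hP : IsPVM P) (Y : H →L[ℂ] HTensor H K)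
    (hY : ∀ X, MeasurableSet X → ∀ B : H →L[ℂ] H, IsDualValue (I X) B
      (ContinuousLinearMap.adjoint Y ∘L tmap B (P X) ∘L Y))
    {U : HTensor H K ≃ₗᵢ[ℂ] HTensor H K} {ξ : K} (hξ : ‖ξ‖ = 1)
    (hU : ∀ ψ, U (tmul ψ ξ) = Y ψ) : IsNormalRealization I P U ξ where
  pvm := hP
  unit := hξ
  realizes X hX B := by
    have h : unitaryTmulRight U ξ = Y := ContinuousLinearMap.ext hU
    rw [← adjoint_unitaryTmulRight_comp, h]
    exact hY X hX B

/-- Any other realization yields the dilating operator `U' Y_ξ'`. Uniqueness of dual values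
identifies its compressions with those of `Y`, so the intertwiner applies. -/
theorem IsMinimalStinespring.isMinimalNormalRealization [Nontrivial H]
    {Y : H →ₗᵢ[ℂ] HTensor H K} (hY : IsMinimalStinespring I P Y)
    {U : HTensor H K ≃ₗᵢ[ℂ] HTensor H K} {ξ : K} (hξ : ‖ξ‖ = 1)
    (hU : ∀ ψ, U (tmul ψ ξ) = Y ψ) : IsMinimalNormalRealization.{u, v, w, t} I P U ξ where
  toIsNormalRealization := isNormalRealization_of_dilates hY.pvm Y.toContinuousLinearMap
    hY.dilates hξ hU
  minimalDilation := by
    rw [show (fun ψ : H => U (tmul ψ ξ)) = Y from funext hU]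
    exact hY.minimal
  embeds K' _ _ _ P' U' ξ' h' := by
    obtain ⟨W, h1, h2⟩ := exists_intertwiner hY.pvm h'.pvm Y.toContinuousLinearMap
      (unitaryTmulRight U' ξ') hY.minimal fun X hX B => by
        rw [adjoint_unitaryTmulRight_comp]
        exact (hY.dilates X hX B).unique (h'.realizes X hX B)
    exact ⟨W, h1, fun ψ => by rw [hU]; exact h2 ψ⟩

end Realization

/-! ### Invariance of the Hilbert space dimension. -/

section HilbertDimension

open Cardinal

variable {E : Type*} [NormedAddCommGroup E] [InnerProductSpace ℂ E]

theorem _root_.HilbertBasis.exists_inner_ne_zero {ι : Type*} (b : HilbertBasis ι ℂ E) {x : E}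
    (hx : x ≠ 0) : ∃ i, ⟪b i, x⟫_ℂ ≠ 0 := by
  by_contra! h
  refine hx (b.repr.injective (lp.ext (funext fun i => ?_)))
  rw [b.repr_apply_apply, h, map_zero]; rfl

/-- Each `b i` is nonorthogonal to only countably many `b' j`, and every `b' j` is nonorthogonal to
some `b i`. Hence `#ι' ≤ #ι * ℵ₀ = #ι`. -/
theorem _root_.HilbertBasis.mk_le_of_infinite {ι ι' : Type w} [Infinite ι]
    (b : HilbertBasis ι ℂ E) (b' : HilbertBasis ι' ℂ E) : #ι' ≤ #ι := by
  have hc : ∀ i, {j | ⟪b i, b' j⟫_ℂ ≠ 0}.Countable := fun i => by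
    have h := (b'.summable_inner_mul_inner (b i) (b i)).countable_support
    refine h.mono fun j hj => ?_
    rw [Function.mem_support, ← inner_conj_symm (b' j), Complex.mul_conj]
    simpa using hj
  have hu : (Set.univ : Set ι') = ⋃ i, {j | ⟪b i, b' j⟫_ℂ ≠ 0} := by
    ext j
    simpa using b.exists_inner_ne_zero (b'.orthonormal.ne_zero j)
  calc #ι' = #(Set.univ : Set ι') := mk_univ.symm
    _ ≤ #ι * ⨆ i, #{j | ⟪b i, b' j⟫_ℂ ≠ 0} := by rw [hu]; exact mk_iUnion_le _
    _ ≤ #ι * ℵ₀ := by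
      gcongr
      exact ciSup_le' fun i => (hc i).le_aleph0
    _ = #ι := mul_aleph0_eq (aleph0_le_mk ι)

/-- All Hilbert bases of a Hilbert space have the same cardinality. -/
theorem _root_.HilbertBasis.mk_eq {ι ι' : Type w}
    (b : HilbertBasis ι ℂ E) (b' : HilbertBasis ι' ℂ E) : #ι = #ι' := by
  have key : ∀ {ι ι' : Type w}, Finite ι → HilbertBasis ι ℂ E → HilbertBasis ι' ℂ E →
      #ι = #ι' := by
    intro ι ι' _ b b'
    have := Fintype.ofFinite ι
    have hfd : FiniteDimensional ℂ E := b.toOrthonormalBasis.toBasis.finiteDimensional_of_finite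
    have : Finite ι' := b'.orthonormal.linearIndependent.finite
    have := Fintype.ofFinite ι'
    rw [mk_fintype, mk_fintype, ← Module.finrank_eq_card_basis b.toOrthonormalBasis.toBasis,
      ← Module.finrank_eq_card_basis b'.toOrthonormalBasis.toBasis]
  rcases finite_or_infinite ι with h | h
  · exact key h b b'
  · rcases finite_or_infinite ι' with h' | h'
    · exact (key h' b' b).symm
    · exact le_antisymm (b'.mk_le_of_infinite b) (b.mk_le_of_infinite b')

end HilbertDimension

/-! ### Extending a partial isometry to a unitary. -/

section UnitaryExtension

variable {H : Type*} [NormedAddCommGroup H] [InnerProductSpace ℂ H]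
  {E : Type w} [NormedAddCommGroup E] [InnerProductSpace ℂ E]

/-- Orthonormal vectors are at distance `√2`, so the balls of radius `1/2` around them are disjoint,
and a separable space holds only countably many disjoint nonempty open sets. -/
theorem _root_.Orthonormal.countable [TopologicalSpace.SeparableSpace H] {s : Type*} {c : s → H}
    (hc : Orthonormal ℂ c) : Countable s := by
  have hd : (Set.univ : Set s).PairwiseDisjoint fun i => Metric.ball (c i) (1 / 2) := by
    intro i _ j _ hij
    refine Set.disjoint_left.2 fun x hi hj => ?_
    have h1 : ‖c i - c j‖ < 1 := by
      rw [← dist_eq_norm]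
      rw [Metric.mem_ball'] at hi
      rw [Metric.mem_ball] at hj
      linarith [dist_triangle (c i) x (c j)]
    have h2 : ‖c i - c j‖ ^ 2 = 2 := by
      rw [@norm_sub_sq ℂ, hc.1, hc.1, hc.2 hij]
      norm_num
    nlinarith [norm_nonneg (c i - c j)]
  exact Set.countable_univ_iff.1 (hd.countable_of_isOpen (fun _ _ => Metric.isOpen_ball)
    fun i _ => ⟨c i, Metric.mem_ball_self (by norm_num)⟩)

/-- The orthogonal complement of the range of an isometry. -/
noncomputable abbrev rangeOrthogonal (A : H →ₗᵢ[ℂ] E) : Submodule ℂ E :=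
  (LinearMap.range A.toLinearMap)ᗮ

theorem mem_rangeOrthogonal {A : H →ₗᵢ[ℂ] E} {x : E} :
    x ∈ rangeOrthogonal A ↔ ∀ ψ, ⟪A ψ, x⟫_ℂ = 0 := by
  rw [Submodule.mem_orthogonal]
  exact ⟨fun h ψ => h _ ⟨ψ, rfl⟩, by rintro h _ ⟨ψ, rfl⟩; exact h ψ⟩

variable [CompleteSpace H] [CompleteSpace E]

/-- A Hilbert basis of `H` and one of the complement of `A H` form a Hilbert basis. -/
theorem exists_hilbertBasis_sum (A : H →ₗᵢ[ℂ] E) {s : Type*} (c : HilbertBasis s ℂ H)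
    {ι : Type*} (d : HilbertBasis ι ℂ (rangeOrthogonal A)) :
    ∃ b : HilbertBasis (s ⊕ ι) ℂ E, ∀ i, b (Sum.inl i) = A (c i) := by
  classical
  let f : s ⊕ ι → E := Sum.elim (fun i => A (c i)) (fun j => (d j : E))
  have hc := c.orthonormal
  have hd := d.orthonormal
  have hf : Orthonormal ℂ f := by
    rw [orthonormal_iff_ite] at hc hd ⊢
    rintro (i | i) (j | j)
    · simpa [f, LinearIsometry.inner_map_map] using hc i j
    · simpa [f] using mem_rangeOrthogonal.1 (d j).2 (c i)
    · simpa [f] using inner_eq_zero_symm.1 (mem_rangeOrthogonal.1 (d i).2 (c j))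
    · simpa [f] using hd i j
  have hsp : (Submodule.span ℂ (Set.range f))ᗮ = ⊥ := by
    rw [Submodule.eq_bot_iff]
    intro x hx
    rw [Submodule.mem_orthogonal] at hx
    have hx' : ∀ i, ⟪f i, x⟫_ℂ = 0 := fun i => hx _ (Submodule.subset_span ⟨i, rfl⟩)
    have h1 : ContinuousLinearMap.adjoint A.toContinuousLinearMap x = 0 := by
      by_contra h
      obtain ⟨i, hi⟩ := c.exists_inner_ne_zero h
      rw [ContinuousLinearMap.adjoint_inner_right] at hi
      exact hi (hx' (Sum.inl i))
    have h2 : x ∈ rangeOrthogonal A := mem_rangeOrthogonal.2 fun ψ => by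
      have := ContinuousLinearMap.adjoint_inner_right A.toContinuousLinearMap ψ x
      rw [h1, inner_zero_right] at this
      exact this.symm
    by_contra h
    obtain ⟨i, hi⟩ := d.exists_inner_ne_zero (x := ⟨x, h2⟩) (by simpa using h)
    exact hi (hx' (Sum.inr i))
  refine ⟨HilbertBasis.mkOfOrthogonalEqBot hf hsp, fun i => ?_⟩
  rw [HilbertBasis.coe_mkOfOrthogonalEqBot]
  rfl

theorem exists_unitary_of_index {s : Type} (c : HilbertBasis s ℂ H) (A B : H →ₗᵢ[ℂ] E)
    (h : Finite s ∨ Countable s ∧ ¬ FiniteDimensional ℂ (rangeOrthogonal A) ∧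
      ¬ FiniteDimensional ℂ (rangeOrthogonal B)) :
    ∃ U : E ≃ₗᵢ[ℂ] E, ∀ ψ, U (A ψ) = B ψ := by
  obtain ⟨ι, d, -⟩ := exists_hilbertBasis ℂ (rangeOrthogonal A)
  obtain ⟨ι', d', -⟩ := exists_hilbertBasis ℂ (rangeOrthogonal B)
  obtain ⟨b, hb⟩ := exists_hilbertBasis_sum A c d
  obtain ⟨b', hb'⟩ := exists_hilbertBasis_sum B c d'
  have hcard : Cardinal.mk ι = Cardinal.mk ι' := by
    have h1 := b.mk_eq b'
    rw [Cardinal.mk_sum, Cardinal.mk_sum, Cardinal.lift_id', Cardinal.lift_id'] at h1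
    -- A finite `#s` cancels from `#s + #ι = #s + #ι'`; a countable one is absorbed by the infinite
    -- cardinals `#ι` and `#ι'`.
    rcases h with h | ⟨hs, hA, hB⟩
    · exact Cardinal.eq_of_add_eq_add_left h1 (by simp)
    · have key : ∀ {F : Submodule ℂ E} {κ : Set F}, HilbertBasis κ ℂ F →
          ¬ FiniteDimensional ℂ F → Cardinal.aleph0 ≤ Cardinal.mk κ := by
        intro F κ a hF
        by_contra! hκ
        have := Cardinal.lt_aleph0_iff_finite.1 hκ
        have := Fintype.ofFinite κ
        exact hF a.toOrthonormalBasis.toBasis.finiteDimensional_of_finite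
      have hs' : Cardinal.lift.{w} (Cardinal.mk s) ≤ Cardinal.aleph0 := by
        simp
      rwa [Cardinal.add_eq_right (key d hA) (hs'.trans (key d hA)),
        Cardinal.add_eq_right (key d' hB) (hs'.trans (key d' hB))] at h1
  obtain ⟨e⟩ := Cardinal.eq.1 hcard
  classical
  -- Reindexing `b'` along `e` gives both bases the same index set, with `A (c i)` and `B (c i)` at
  -- the same place. `U` maps one basis to the other.
  have : ∃ b'' : HilbertBasis (s ⊕ ι) ℂ E, ∀ i, b'' i = b' (Equiv.sumCongr (Equiv.refl s) e i) := by
    refine ⟨HilbertBasis.mk (v := b' ∘ Equiv.sumCongr (Equiv.refl s) e)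
      (b'.orthonormal.comp _ (Equiv.injective _)) ?_, fun i => by rw [HilbertBasis.coe_mk]; rfl⟩
    rw [EquivLike.range_comp, b'.dense_span]
  obtain ⟨b'', hb''⟩ := this
  let U := b.repr.trans b''.repr.symm
  have hU : ∀ i, U (A (c i)) = B (c i) := fun i => by
    have h1 := hb'' (Sum.inl i)
    simp only [Equiv.sumCongr_apply, Sum.map_inl, Equiv.refl_apply, hb'] at h1
    rw [← hb, ← h1]
    simp [U, b.repr_self, b''.repr_symm_single]
  refine ⟨U, fun ψ => ?_⟩
  have : (U.toLinearIsometry.comp A).toContinuousLinearMap = B.toContinuousLinearMap := by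
    refine ContinuousLinearMap.ext_on
      ((Submodule.dense_iff_topologicalClosure_eq_top).2 c.dense_span) ?_
    rintro _ ⟨i, rfl⟩
    exact hU i
  exact DFunLike.congr_fun this ψ

/-- Two isometries are related by a unitary operator when their complements have equal
dimensions. -/
theorem exists_unitary_comp_eq [TopologicalSpace.SeparableSpace H] (A B : H →ₗᵢ[ℂ] E)
    (h : ¬ FiniteDimensional ℂ H → ¬ FiniteDimensional ℂ (rangeOrthogonal A) ∧
      ¬ FiniteDimensional ℂ (rangeOrthogonal B)) :
    ∃ U : E ≃ₗᵢ[ℂ] E, ∀ ψ, U (A ψ) = B ψ := by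
  by_cases hH : FiniteDimensional ℂ H
  · exact exists_unitary_of_index (stdOrthonormalBasis ℂ H).toHilbertBasis A B (Or.inl inferInstance)
  · obtain ⟨s, c, hc⟩ := exists_hilbertBasis ℂ H
    have hs : Countable s := c.orthonormal.countable
    have hinf : Infinite s := by
      by_contra hs'
      rw [not_infinite_iff_finite] at hs'
      have := Fintype.ofFinite s
      exact hH c.toOrthonormalBasis.toBasis.finiteDimensional_of_finite
    -- The index set `s` is a subtype of `H`; passing to `ℕ` puts it in `Type`, as
    -- `exists_unitary_of_index` needs.
    obtain ⟨e⟩ : Nonempty (ℕ ≃ s) := ⟨(nonempty_denumerable s).some.eqv.symm⟩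
    have c' : HilbertBasis ℕ ℂ H := HilbertBasis.mk (v := c ∘ e)
      (c.orthonormal.comp _ e.injective) (by rw [EquivLike.range_comp, c.dense_span])
    exact exists_unitary_of_index c' A B (Or.inr ⟨inferInstance, h hH⟩)

end UnitaryExtension

/-! ### Infinite dimensional complements in `H ⊗ K`. -/

section Complements

variable {H : Type*} [NormedAddCommGroup H] [InnerProductSpace ℂ H]
  {K : Type*} [NormedAddCommGroup K] [InnerProductSpace ℂ K]

variable (H) in
/-- The isometry `ψ ↦ ψ ⊗ ξ` of a unit vector `ξ`. -/
noncomputable def tmulRightIsometry {ξ : K} (hξ : ‖ξ‖ = 1) : H →ₗᵢ[ℂ] HTensor H K where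
  toLinearMap := (tmulRight H ξ).toLinearMap
  norm_map' ψ := (norm_tmul ψ ξ).trans (by rw [hξ, mul_one])

theorem tmulRightIsometry_apply {ξ : K} (hξ : ‖ξ‖ = 1) (ψ : H) :
    tmulRightIsometry H hξ ψ = tmul ψ ξ := rfl

/-- The injection `φ ↦ φ ⊗ η` places a copy of `H` in the complement. -/
theorem not_finiteDimensional_rangeOrthogonal (hH : ¬ FiniteDimensional ℂ H)
    (A : H →ₗᵢ[ℂ] HTensor H K) {η : K} (hη : η ≠ 0)
    (hA : ∀ ψ φ, ⟪A ψ, tmul φ η⟫_ℂ = 0) : ¬ FiniteDimensional ℂ (rangeOrthogonal A) := by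
  intro h
  refine hH (FiniteDimensional.of_injective
    ((tmulRight H η).toLinearMap.codRestrict (rangeOrthogonal A) fun φ =>
      mem_rangeOrthogonal.2 fun ψ => hA ψ φ) ?_)
  refine (injective_iff_map_eq_zero _).2 fun φ hφ => ?_
  have h1 : tmul φ η = 0 := congrArg Subtype.val hφ
  have h2 := norm_tmul φ η
  rw [h1, norm_zero] at h2
  simpa [hη] using h2.symm

theorem not_finiteDimensional_rangeOrthogonal_tmulRight (hH : ¬ FiniteDimensional ℂ H)
    {ξ : K} (hξ : ‖ξ‖ = 1) (h : ∃ x : K, ∀ c : ℂ, x ≠ c • ξ) :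
    ¬ FiniteDimensional ℂ (rangeOrthogonal (tmulRightIsometry H hξ)) := by
  obtain ⟨x, hx⟩ := h
  -- Here `η = x - ⟪ξ, x⟫ ξ`, the part of `x` orthogonal to `ξ`.
  refine not_finiteDimensional_rangeOrthogonal hH _ (sub_ne_zero.2 (hx ⟪ξ, x⟫_ℂ)) fun ψ φ => ?_
  rw [tmulRightIsometry_apply, inner_tmul, inner_sub_right, inner_smul_right,
    inner_self_eq_norm_sq_to_K, hξ]
  simp

theorem nontrivial_of_linearIsometry_hTensor [Nontrivial H] (Y : H →ₗᵢ[ℂ] HTensor H K) :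
    Nontrivial K := by
  by_contra hK
  rw [not_nontrivial_iff_subsingleton] at hK
  have h0 : ContinuousLinearMap.id ℂ (HTensor H K) = 0 :=
    continuousLinearMap_ext_tmul fun a b => by
      have h := norm_tmul a b
      rw [Subsingleton.elim b 0, norm_zero, mul_zero, norm_eq_zero] at h
      simp [Subsingleton.elim b 0, h]
  obtain ⟨ψ, hψ⟩ := exists_ne (0 : H)
  have : Y ψ = 0 := DFunLike.congr_fun h0 (Y ψ)
  exact hψ ((map_eq_zero_iff Y Y.injective).1 this)

end Complements

/-! ### The pointer and isometry on `K ⊕ ℂ`. -/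

section ExtendedPointer

variable {Ω : Type*}
  {H : Type*} [NormedAddCommGroup H] [InnerProductSpace ℂ H]
  {K : Type*} [NormedAddCommGroup K] [InnerProductSpace ℂ K]

theorem inExtend_apply (x : K) : inExtend K x = WithLp.toLp 2 (x, 0) := rfl

open Classical in
theorem extendPointer_apply (P : Set Ω → K →L[ℂ] K) (S : Set (Option Ω)) (z : Extend K) :
    extendPointer P S z =
      WithLp.toLp 2 (P (some ⁻¹' S) z.fst, if none ∈ S then z.snd else 0) := by
  unfold extendPointer
  split_ifs <;> rfl

theorem inner_inExtend (x y : K) : ⟪inExtend K x, inExtend K y⟫_ℂ = ⟪x, y⟫_ℂ := by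
  simp [inExtend_apply, WithLp.prod_inner_apply]

theorem extendPointer_comp_inExtend (P : Set Ω → K →L[ℂ] K) (S : Set (Option Ω)) :
    extendPointer P S ∘L inExtend K = inExtend K ∘L P (some ⁻¹' S) := by
  ext1 x
  simp [extendPointer_apply, inExtend_apply]

variable [CompleteSpace K]

theorem adjoint_inExtend_comp : ContinuousLinearMap.adjoint (inExtend K) ∘L inExtend K =
    ContinuousLinearMap.id ℂ K := by
  ext x
  refine ext_inner_left ℂ fun y => ?_
  rw [ContinuousLinearMap.comp_apply, ContinuousLinearMap.adjoint_inner_right, inner_inExtend]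
  rfl

variable [CompleteSpace H]

/-- The range of `Y₊` lies in `H ⊗ (K ⊕ 0)`, where `P₊` acts as `P`; the added dimension is not
seen. -/
theorem adjoint_extendIsometry_comp (Y : H →ₗᵢ[ℂ] HTensor H K) (P : Set Ω → K →L[ℂ] K)
    (S : Set (Option Ω)) (B : H →L[ℂ] H) :
    ContinuousLinearMap.adjoint (extendIsometry Y) ∘L tmap B (extendPointer P S) ∘L
      extendIsometry Y =
    ContinuousLinearMap.adjoint Y.toContinuousLinearMap ∘L tmap B (P (some ⁻¹' S)) ∘L
      Y.toContinuousLinearMap := by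
  unfold extendIsometry
  rw [ContinuousLinearMap.adjoint_comp, adjoint_tmap]
  ext1 ψ
  simp only [ContinuousLinearMap.comp_apply, tmap_tmap]
  have h : ContinuousLinearMap.adjoint (inExtend K) ∘L inExtend K ∘L P (some ⁻¹' S) =
      P (some ⁻¹' S) := by
    rw [← ContinuousLinearMap.comp_assoc, adjoint_inExtend_comp, ContinuousLinearMap.id_comp]
  rw [extendPointer_comp_inExtend, h, ContinuousLinearMap.adjoint_id,
    ContinuousLinearMap.id_comp, ContinuousLinearMap.comp_id]

variable [MeasurableSpace Ω]

theorem measurableSet_preimage_some {S : Set (Option Ω)} (hS : MeasurableSet S) :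
    MeasurableSet (some ⁻¹' S) :=
  (measurableSet_extended_iff S).1 hS

theorem isStarProjection_extendPointer {P : Set Ω → K →L[ℂ] K} (hP : IsPVM P)
    {S : Set (Option Ω)} (hS : MeasurableSet S) : IsStarProjection (extendPointer P S) := by
  have h := hP.projection _ (measurableSet_preimage_some hS)
  have hi := h.isIdempotentElem.eq
  constructor
  · refine ContinuousLinearMap.ext fun z => ?_
    have := DFunLike.congr_fun hi z.fst
    rw [mul_apply_eq_comp] at this
    simp only [mul_apply_eq_comp, extendPointer_apply]
    split_ifs <;> simp [this]
  · rw [ContinuousLinearMap.isSelfAdjoint_iff_isSymmetric]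
    intro y z
    have := (ContinuousLinearMap.isSelfAdjoint_iff_isSymmetric.1 h.isSelfAdjoint) y.fst z.fst
    simp only [ContinuousLinearMap.coe_coe] at this
    simp only [ContinuousLinearMap.coe_coe, extendPointer_apply, WithLp.prod_inner_apply]
    split_ifs <;> simpa using this

theorem isPVM_extendPointer {P : Set Ω → K →L[ℂ] K} (hP : IsPVM P) :
    IsPVM (extendPointer P) where
  projection S hS := isStarProjection_extendPointer hP hS
  positive S hS := (ContinuousLinearMap.nonneg_iff_isPositive _).1
    (isStarProjection_extendPointer hP hS).nonneg
  normalized := by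
    refine ContinuousLinearMap.ext fun z => ?_
    simp [extendPointer_apply, hP.normalized]
    rfl
  sigmaAdditive X hX hd y z := by
    classical
    have h1 := hP.sigmaAdditive (fun i => some ⁻¹' X i) (fun i => measurableSet_preimage_some (hX i))
      (fun i j hij => (hd hij).preimage _) y.fst z.fst
    -- At most one of the disjoint sets contains `none`, so at most one term can be nonzero.
    have h2 : HasSum (fun i => if none ∈ X i then ⟪y.snd, z.snd⟫_ℂ else 0)
        (if none ∈ ⋃ i, X i then ⟪y.snd, z.snd⟫_ℂ else 0) := by
      split_ifs with h
      · obtain ⟨i, hi⟩ := Set.mem_iUnion.1 h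
        have := hasSum_single (f := fun i => if none ∈ X i then ⟪y.snd, z.snd⟫_ℂ else 0) i
          fun j hj => if_neg fun hj' => Set.disjoint_left.1 (hd hj) hj' hi
        rwa [if_pos hi] at this
      · have : ∀ i, none ∉ X i := fun i hi => h (Set.mem_iUnion.2 ⟨i, hi⟩)
        simp [this]
    rw [← Set.preimage_iUnion] at h1
    have key : ∀ S : Set (Option Ω), ⟪y, extendPointer P S z⟫_ℂ =
        ⟪y.fst, P (some ⁻¹' S) z.fst⟫_ℂ + if none ∈ S then ⟪y.snd, z.snd⟫_ℂ else 0 := fun S => by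
      rw [extendPointer_apply, WithLp.prod_inner_apply]
      split_ifs <;> simp
    simp only [key]
    exact h1.add h2

/-- `Y₊` is an isometry. -/
noncomputable def extendLinearIsometry (Y : H →ₗᵢ[ℂ] HTensor H K) :
    H →ₗᵢ[ℂ] HTensor H (Extend K) where
  toLinearMap := (extendIsometry Y).toLinearMap
  norm_map' ψ := by
    have h : ContinuousLinearMap.adjoint (tmap (ContinuousLinearMap.id ℂ H) (inExtend K)) ∘L
        tmap (ContinuousLinearMap.id ℂ H) (inExtend K) = ContinuousLinearMap.id ℂ _ := by
      rw [adjoint_tmap, tmap_comp, adjoint_inExtend_comp, ContinuousLinearMap.comp_id,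
        ContinuousLinearMap.adjoint_id, tmap_id_id]
    rw [← Y.norm_map]
    exact (ContinuousLinearMap.norm_map_iff_adjoint_comp_self _).2 h (Y ψ)

theorem inner_extendIsometry_tmul (Y : H →ₗᵢ[ℂ] HTensor H K) (ψ φ : H) (c : ℂ) :
    ⟪extendIsometry Y ψ, tmul φ (WithLp.toLp 2 ((0 : K), c))⟫_ℂ = 0 := by
  unfold extendIsometry
  rw [ContinuousLinearMap.comp_apply, ← ContinuousLinearMap.adjoint_inner_right, adjoint_tmap,
    tmap_tmul]
  have : ContinuousLinearMap.adjoint (inExtend K) (WithLp.toLp 2 ((0 : K), c)) = 0 :=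
    ext_inner_left ℂ fun y => by
      rw [ContinuousLinearMap.adjoint_inner_right, inExtend_apply]
      simp [WithLp.prod_inner_apply]
  rw [this, ← tmulLeft_apply, map_zero, inner_zero_right]

theorem exists_unitary_extend [TopologicalSpace.SeparableSpace H] [Nontrivial H]
    (Y : H →ₗᵢ[ℂ] HTensor H K) {ξ : Extend K} (hξ : ‖ξ‖ = 1) :
    ∃ U : HTensor H (Extend K) ≃ₗᵢ[ℂ] HTensor H (Extend K),
      ∀ ψ : H, U (tmul ψ ξ) = extendIsometry Y ψ := by
  refine exists_unitary_comp_eq (tmulRightIsometry H hξ) (extendLinearIsometry Y) fun hH =>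
    ⟨not_finiteDimensional_rangeOrthogonal_tmulRight hH hξ ?_,
      not_finiteDimensional_rangeOrthogonal hH _ (η := WithLp.toLp 2 ((0 : K), (1 : ℂ))) ?_
        fun ψ φ => inner_extendIsometry_tmul Y ψ φ 1⟩
  · have := nontrivial_of_linearIsometry_hTensor Y
    -- If `ξ` spanned `K ⊕ ℂ`, then `(0, 1)` being a multiple of `ξ` would kill the `K`-component of
    -- `ξ`, and `(x, 0)` with `x ≠ 0` could not be a multiple of it.
    by_contra! h
    obtain ⟨c, hc⟩ := h (WithLp.toLp 2 ((0 : K), (1 : ℂ)))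
    obtain ⟨x, hx⟩ := exists_ne (0 : K)
    obtain ⟨d, hd⟩ := h (WithLp.toLp 2 (x, (0 : ℂ)))
    have h1 : (0 : K) = c • ξ.fst := congrArg WithLp.fst hc
    have h2 : (1 : ℂ) = c • ξ.snd := congrArg WithLp.snd hc
    have h3 : x = d • ξ.fst := congrArg WithLp.fst hd
    have hc0 : c ≠ 0 := by rintro rfl; simp at h2
    rw [(smul_eq_zero.1 h1.symm).resolve_left hc0, smul_zero] at h3
    exact hx h3
  · intro h
    exact one_ne_zero (congrArg WithLp.snd h : (1 : ℂ) = 0)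

end ExtendedPointer

/-! ### The instrument with a null outcome. -/

section ExtendedInstrument

variable {Ω : Type*}
  {H : Type*} [NormedAddCommGroup H] [InnerProductSpace ℂ H]
  {I : Set Ω → traceClass H →ₗ[ℂ] traceClass H}

theorem extendInstrument_some_image (X : Set Ω) : extendInstrument I (some '' X) = I X := by
  rw [extendInstrument, Set.preimage_image_eq X (Option.some_injective Ω)]

variable [MeasurableSpace Ω] [CompleteSpace H]

theorem IsInstrument.extend (hI : IsInstrument I) : IsInstrument (extendInstrument I) where
  completelyPositive S hS := hI.completelyPositive _ (measurableSet_preimage_some hS)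
  tracePreserving := hI.tracePreserving
  sigmaAdditive X hX hd B T := by
    have := hI.sigmaAdditive (fun i => some ⁻¹' X i)
      (fun i => measurableSet_preimage_some (hX i)) (fun i j hij => (hd hij).preimage _) B T
    rwa [← Set.preimage_iUnion] at this

theorem IsInstrument.empty (hI : IsInstrument I) : I ∅ = 0 := by
  ext T : 1
  refine Subtype.ext (eq_zero_of_trace_comp_eq_zero fun B => ?_)
  have h := hI.sigmaAdditive (fun _ => ∅) (fun _ => .empty) (fun i j _ => disjoint_bot_left) B T
  exact (summable_const_iff _).1 h.summable

theorem IsInstrument.extend_singleton_none (hI : IsInstrument I) :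
    extendInstrument I {none} = 0 := by
  rw [extendInstrument, show (some ⁻¹' {none} : Set Ω) = ∅ by ext; simp, hI.empty]

end ExtendedInstrument

/-! ### Counting orthogonal sections in finite dimensional fibres. -/

section Multiplicity

variable {Ω : Type*} [MeasurableSpace Ω] {μ : Measure Ω} {m : Ω → ℕ∞}

theorem canonicalPVM_coeFn {X : Set Ω} (hX : MeasurableSet X) (f : DirectIntegral μ m) :
    ((canonicalPVM μ m X f).1 : Ω → Seq) =ᵐ[μ] X.indicator (f.1 : Ω → Seq) := by
  rw [canonicalPVM, dif_pos hX]
  exact mulIndicator_coeFn μ m hX f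

theorem inner_canonicalPVM {X : Set Ω} (hX : MeasurableSet X) (g f : DirectIntegral μ m) :
    ⟪g, canonicalPVM μ m X f⟫_ℂ = ∫ x in X, ⟪g.1 x, f.1 x⟫_ℂ ∂μ := by
  rw [Submodule.coe_inner, L2.inner_def, ← integral_indicator hX]
  refine integral_congr_ae ?_
  filter_upwards [canonicalPVM_coeFn hX f] with x hx
  rw [hx]
  by_cases h : x ∈ X <;> simp [h]

/-- Both sides of `h` are integrals over `X` of the fibrewise inner products, and an integrable
function is determined a.e. by such integrals. -/
theorem ae_inner_eq_of_forall_inner_canonicalPVM_eq {g f g' f' : DirectIntegral μ m}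
    (h : ∀ X, MeasurableSet X → ⟪g, canonicalPVM μ m X f⟫_ℂ = ⟪g', canonicalPVM μ m X f'⟫_ℂ) :
    ∀ᵐ x ∂μ, ⟪g.1 x, f.1 x⟫_ℂ = ⟪g'.1 x, f'.1 x⟫_ℂ := by
  refine Integrable.ae_eq_of_forall_setIntegral_eq _ _ (L2.integrable_inner g.1 f.1)
    (L2.integrable_inner g'.1 f'.1) fun X hX _ => ?_
  rw [← inner_canonicalPVM hX, ← inner_canonicalPVM hX, h X hX]

/-- The standard `n`-dimensional space does not contain `n + 1` orthogonal vectors of equal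
positive norm. -/
theorem eq_zero_of_orthogonal_of_support {n : ℕ} (w : Fin (n + 1) → Seq)
    (hs : ∀ i, ∀ k : ℕ, n ≤ k → (w i : ℕ → ℂ) k = 0)
    (ho : ∀ i j, i ≠ j → ⟪w i, w j⟫_ℂ = 0) (hn : ∀ i, ⟪w i, w i⟫_ℂ = ⟪w 0, w 0⟫_ℂ) :
    w 0 = 0 := by
  by_contra h0
  have hne : ∀ i, w i ≠ 0 := fun i hi => h0 (by
    have := hn i
    rw [hi, inner_zero_left] at this
    exact inner_self_eq_zero.1 this.symm)
  have hli : LinearIndependent ℂ w := linearIndependent_of_ne_zero_of_inner_eq_zero hne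
    fun i j hij => ho i j hij
  -- `R` keeps the first `n` coordinates. It is injective on `S`, which contains all `w i`, so it
  -- would produce `n + 1` independent vectors in `ℂⁿ`.
  let R : Seq →ₗ[ℂ] (Fin n → ℂ) :=
    { toFun := fun v k => (v : ℕ → ℂ) k
      map_add' := fun _ _ => rfl
      map_smul' := fun _ _ => rfl }
  let S : Submodule ℂ Seq :=
    { carrier := {v | ∀ k : ℕ, n ≤ k → (v : ℕ → ℂ) k = 0}
      zero_mem' := fun _ _ => rfl
      add_mem' := fun {a b} ha hb k hk => by
        rw [lp.coeFn_add, Pi.add_apply, ha k hk, hb k hk, add_zero]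
      smul_mem' := fun c a ha k hk => by
        rw [lp.coeFn_smul, Pi.smul_apply, ha k hk, smul_zero] }
  have hR : LinearIndependent ℂ (R ∘ w) := by
    refine hli.map (Submodule.disjoint_def.2 fun v hv hv' => ?_)
    have hvS : v ∈ S := (Submodule.span_le.2 (by rintro _ ⟨i, rfl⟩; exact hs i)) hv
    refine lp.ext (funext fun k => ?_)
    rcases lt_or_ge k n with hk | hk
    · exact congrFun (LinearMap.mem_ker.1 hv') ⟨k, hk⟩
    · exact hvS k hk
  have := hR.fintype_card_le_finrank
  simp at this

theorem canonicalPVM_apply_eq_zero_of_orthogonal {n : ℕ} {A : Set Ω} (hA : MeasurableSet A)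
    (hm : ∀ x ∈ A, m x = n) (g : Fin (n + 1) → DirectIntegral μ m)
    (ho : ∀ i j, i ≠ j → ∀ X, MeasurableSet X → ⟪g i, canonicalPVM μ m X (g j)⟫_ℂ = 0)
    (hn : ∀ i X, MeasurableSet X →
      ⟪g i, canonicalPVM μ m X (g i)⟫_ℂ = ⟪g 0, canonicalPVM μ m X (g 0)⟫_ℂ) :
    canonicalPVM μ m A (g 0) = 0 := by
  have h1 : ∀ᵐ x ∂μ, ∀ i, ⟪(g i).1 x, (g i).1 x⟫_ℂ = ⟪(g 0).1 x, (g 0).1 x⟫_ℂ :=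
    ae_all_iff.2 fun i => ae_inner_eq_of_forall_inner_canonicalPVM_eq (hn i)
  have h2 : ∀ᵐ x ∂μ, ∀ i j, i ≠ j → ⟪(g i).1 x, (g j).1 x⟫_ℂ = 0 := by
    refine ae_all_iff.2 fun i => ae_all_iff.2 fun j => ?_
    by_cases hij : i = j
    · exact Filter.Eventually.of_forall fun x h => (h hij).elim
    · have h := ae_inner_eq_of_forall_inner_canonicalPVM_eq (g := g i) (f := g j) (g' := g i)
        (f' := 0) fun X hX => by rw [ho i j hij X hX, map_zero, inner_zero_right]
      filter_upwards [h, Lp.coeFn_zero Seq 2 μ] with x hx hx0 _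
      rw [hx]
      change ⟪(g i).1 x, (0 : Lp Seq 2 μ) x⟫_ℂ = 0
      rw [hx0, Pi.zero_apply, inner_zero_right]
  have h3 : ∀ᵐ x ∂μ, ∀ i, ∀ k : ℕ, m x ≤ (k : ℕ∞) → ((g i).1 x : ℕ → ℂ) k = 0 :=
    ae_all_iff.2 fun i => (g i).2
  refine Subtype.ext (Lp.ext ?_)
  filter_upwards [h1, h2, h3, canonicalPVM_coeFn hA (g 0), Lp.coeFn_zero Seq 2 μ]
    with x h1 h2 h3 h4 h5
  rw [h4]
  refine Eq.trans ?_ h5.symm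
  by_cases hx : x ∈ A
  · rw [Set.indicator_of_mem hx]
    exact eq_zero_of_orthogonal_of_support (fun i => (g i).1 x)
      (fun i k hk => h3 i k (by rw [hm x hx]; exact_mod_cast hk)) h2 h1
  · rw [Set.indicator_of_notMem hx]; rfl

theorem exists_level_ne_zero (hm : Measurable m) (h : ¬ ∀ᵐ x ∂μ, m x = ⊤) :
    ∃ n : ℕ, MeasurableSet {x | m x = n} ∧ μ {x | m x = n} ≠ 0 := by
  by_contra! hn
  have h1 : ∀ᵐ x ∂μ, ∀ n : ℕ, m x ≠ n := ae_all_iff.2 fun n => by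
    have := hn n (hm (measurableSet_singleton _))
    rw [ae_iff]
    simpa using this
  refine h ?_
  filter_upwards [h1] with x hx
  by_contra ht
  obtain ⟨k, hk⟩ := ENat.ne_top_iff_exists.1 ht
  exact hx k hk.symm

end Multiplicity

theorem exists_orthonormal_fin {E : Type*} [NormedAddCommGroup E] [InnerProductSpace ℂ E]
    (hE : ¬ FiniteDimensional ℂ E) (n : ℕ) : ∃ h : Fin n → E, Orthonormal ℂ h := by
  have hr : (n : Cardinal) ≤ Module.rank ℂ E := by
    by_contra! h
    exact hE (Module.rank_lt_aleph0_iff.1 (h.trans (Cardinal.natCast_lt_aleph0)))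
  obtain ⟨f, hf⟩ := Module.le_rank_iff.1 hr
  exact ⟨_, InnerProductSpace.gramSchmidtNormed_orthonormal hf⟩

theorem finiteDimensional_of_ker {E F : Type*} [AddCommGroup E] [Module ℂ E] [AddCommGroup F]
    [Module ℂ F] [FiniteDimensional ℂ F] (q : E →ₗ[ℂ] F)
    (h : FiniteDimensional ℂ (LinearMap.ker q)) : FiniteDimensional ℂ E := by
  have : FiniteDimensional ℂ (E ⧸ LinearMap.ker q) :=
    q.quotKerEquivRange.symm.finiteDimensional
  exact Module.Finite.of_submodule_quotient (LinearMap.ker q)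

/-! ### The associated observable and its Naimark dilation. -/

section AssociatedObservable

variable {Ω : Type*} [MeasurableSpace Ω]
  {H : Type*} [NormedAddCommGroup H] [InnerProductSpace ℂ H] [CompleteSpace H]
  {K : Type*} [NormedAddCommGroup K] [InnerProductSpace ℂ K] [CompleteSpace K]
  {I : Set Ω → traceClass H →ₗ[ℂ] traceClass H} {M : Set Ω → H →L[ℂ] H}
  {P : Set Ω → K →L[ℂ] K} {Y : H →ₗᵢ[ℂ] HTensor H K}

/-- The states `|ψ⟩⟨ψ|` together with `B = 1` give equal quadratic forms on unit vectors; scaling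
and polarization give equal operators. -/
theorem IsStinespring.associated_eq (hY : IsStinespring I P Y) (hIM : IsAssociated I M)
    {X : Set Ω} (hX : MeasurableSet X) :
    M X = ContinuousLinearMap.adjoint Y.toContinuousLinearMap ∘L
      tmap (ContinuousLinearMap.id ℂ H) (P X) ∘L Y.toContinuousLinearMap := by
  set D := ContinuousLinearMap.adjoint Y.toContinuousLinearMap ∘L
      tmap (ContinuousLinearMap.id ℂ H) (P X) ∘L Y.toContinuousLinearMap
  have hunit : ∀ ψ : H, ‖ψ‖ = 1 → ⟪ψ, M X ψ⟫_ℂ = ⟪ψ, D ψ⟫_ℂ := fun ψ hψ => by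
    have h1 := hIM X hX ⟨_, rankOne_mem_traceClass ψ ψ⟩ (rankOne_self_isPositive ψ) (by
      rw [trace_rankOne, inner_self_eq_norm_sq_to_K, hψ]; simp)
    have h2 := hY.dilates X hX (ContinuousLinearMap.id ℂ H) ⟨_, rankOne_mem_traceClass ψ ψ⟩
    rw [ContinuousLinearMap.id_comp, ← h1, comp_rankOne, comp_rankOne, trace_rankOne,
      trace_rankOne] at h2
    exact h2.symm
  have hall : ∀ ψ : H, ⟪ψ, M X ψ⟫_ℂ = ⟪ψ, D ψ⟫_ℂ := fun ψ => by
    by_cases h0 : ψ = 0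
    · simp [h0]
    · have h := hunit (((‖ψ‖⁻¹ : ℝ) : ℂ) • ψ) (by
        rw [norm_smul]; simp [norm_ne_zero_iff.2 h0])
      simp only [map_smul, inner_smul_left, inner_smul_right] at h
      have hc : ((‖ψ‖⁻¹ : ℝ) : ℂ) ≠ 0 := by simpa using h0
      exact mul_left_cancel₀ ((map_ne_zero (starRingEnd ℂ)).2 hc) (mul_left_cancel₀ hc h)
  have : (M X : H →ₗ[ℂ] H) = D := (ext_inner_map _ _).1 fun ψ => by
    have := congrArg (starRingEnd ℂ) (hall ψ)
    rwa [inner_conj_symm, inner_conj_symm] at this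
  exact ContinuousLinearMap.coe_injective this

theorem IsStinespring.inner_associated (hY : IsStinespring I P Y) (hIM : IsAssociated I M)
    {X : Set Ω} (hX : MeasurableSet X) (ψ φ : H) :
    ⟪ψ, M X φ⟫_ℂ = ⟪Y ψ, tmap (ContinuousLinearMap.id ℂ H) (P X) (Y φ)⟫_ℂ := by
  rw [hY.associated_eq hIM hX]
  exact ContinuousLinearMap.adjoint_inner_right Y.toContinuousLinearMap ψ
    (tmap (ContinuousLinearMap.id ℂ H) (P X) (Y φ))

variable {L : Type*} [NormedAddCommGroup L] [InnerProductSpace ℂ L] [CompleteSpace L]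
  {Q : Set Ω → L →L[ℂ] L} {J : H →ₗᵢ[ℂ] L}

theorem IsMinimalNaimark.inner_eq (hJ : IsMinimalNaimark M Q J) {X : Set Ω}
    (hX : MeasurableSet X) (ψ φ : H) : ⟪J ψ, Q X (J φ)⟫_ℂ = ⟪ψ, M X φ⟫_ℂ := by
  rw [hJ.dilates X hX]
  exact (ContinuousLinearMap.adjoint_inner_right J.toContinuousLinearMap _ _).symm

theorem IsPVM.inner_apply_apply {Q : Set Ω → L →L[ℂ] L} (hQ : IsPVM Q) {X Z : Set Ω}
    (hX : MeasurableSet X) (hZ : MeasurableSet Z) (a b : L) :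
    ⟪Q X a, Q Z b⟫_ℂ = ⟪a, Q (X ∩ Z) b⟫_ℂ := by
  rw [← hQ.comp_adjoint hX hZ, ContinuousLinearMap.comp_apply,
    ContinuousLinearMap.adjoint_inner_right]

/-- The minimal Naimark dilation of the associated observable embeds into every Stinespring
dilation of the instrument. -/
theorem IsMinimalNaimark.exists_embedding (hJ : IsMinimalNaimark M Q J)
    (hY : IsStinespring I P Y) (hIM : IsAssociated I M) :
    ∃ Z : L →ₗᵢ[ℂ] HTensor H K, (∀ ψ, Z (J ψ) = Y ψ) ∧
      ∀ X, MeasurableSet X → ∀ g, Z (Q X g) =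
        tmap (ContinuousLinearMap.id ℂ H) (P X) (Z g) := by
  let ι := {X : Set Ω // MeasurableSet X} × H
  let v : ι → L := fun i => Q i.1.1 (J i.2)
  let v' : ι → HTensor H K := fun i => tmap (ContinuousLinearMap.id ℂ H) (P i.1.1) (Y i.2)
  have hv : Dense (Submodule.span ℂ (Set.range v) : Set L) := by
    convert hJ.minimal using 4
    ext x
    constructor
    · rintro ⟨⟨X, ψ⟩, rfl⟩
      exact ⟨X, X.2, ψ, rfl⟩
    · rintro ⟨X, hX, ψ, rfl⟩
      exact ⟨(⟨X, hX⟩, ψ), rfl⟩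
  -- Both Gram matrices have the entries `⟪ψ, M(X ∩ Z) φ⟫`.
  obtain ⟨Z, hZ⟩ := exists_linearIsometry_of_gram v v' hv fun i j => by
    have h := inner_tmap_pvm hY.pvm Y.toContinuousLinearMap (ContinuousLinearMap.id ℂ H)
      (ContinuousLinearMap.id ℂ H) i.1.2 j.1.2 i.2 j.2
    rw [ContinuousLinearMap.adjoint_id, ContinuousLinearMap.id_comp,
      ← hY.associated_eq hIM (i.1.2.inter j.1.2)] at h
    rw [hJ.pvm.inner_apply_apply i.1.2 j.1.2, hJ.inner_eq (i.1.2.inter j.1.2)]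
    exact h.symm
  refine ⟨Z, fun ψ => ?_, fun X hX g => ?_⟩
  · have := hZ (⟨Set.univ, .univ⟩, ψ)
    simpa [v, v', hJ.pvm.normalized, hY.pvm.normalized, tmap_id_id] using this
  · have : Z.toContinuousLinearMap ∘L Q X =
        tmap (ContinuousLinearMap.id ℂ H) (P X) ∘L Z.toContinuousLinearMap := by
      refine ContinuousLinearMap.ext_on hv ?_
      rintro _ ⟨⟨C, ψ⟩, rfl⟩
      have h1 := hZ (⟨X ∩ C.1, hX.inter C.2⟩, ψ)
      have h2 := hZ (C, ψ)
      simp only [v, v', ← hJ.pvm.mul hX C.2, ← hY.pvm.mul hX C.2, mul_apply_eq_comp] at h1 h2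
      simp only [v, ContinuousLinearMap.comp_apply, LinearIsometry.coe_toContinuousLinearMap,
        h1, h2, tmap_tmap]
      rfl
    exact DFunLike.congr_fun this g

end AssociatedObservable

/-! ### Consequences of finite multiplicity on a nonnull set. -/

section RankFinite

variable {Ω : Type*} [MeasurableSpace Ω] {μ : Measure Ω}
  {H : Type*} [NormedAddCommGroup H] [InnerProductSpace ℂ H] [CompleteSpace H]
  {K : Type*} [NormedAddCommGroup K] [InnerProductSpace ℂ K] [CompleteSpace K]
  {I : Set Ω → traceClass H →ₗ[ℂ] traceClass H} {M : Set Ω → H →L[ℂ] H}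
  {P : Set Ω → K →L[ℂ] K} {Y : H →ₗᵢ[ℂ] HTensor H K}

/-- If the associated observable is not rank-`∞`, the range of a Stinespring isometry has infinite
codimension. -/
theorem not_finiteDimensional_rangeOrthogonal_of_not_isRankInfinite
    (hM : ¬ IsRankInfinite μ M) (hμ : MutuallyAC μ M) (hIM : IsAssociated I M)
    (hY : IsStinespring I P Y) (hH : ¬ FiniteDimensional ℂ H) :
    ¬ FiniteDimensional ℂ (rangeOrthogonal Y) := by
  intro hfd
  unfold IsRankInfinite at hM
  push Not at hM
  obtain ⟨m, hm, J, hJ, hne⟩ := hM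
  obtain ⟨n, hA, hA0⟩ := exists_level_ne_zero hm (by simpa using hne)
  set A := {x | m x = n}
  obtain ⟨Z, hZJ, hZ⟩ := hJ.exists_embedding hY hIM
  -- `P A = 0` would give `M A = 0`, hence `μ A = 0`.
  obtain ⟨f, hf0, hf⟩ : ∃ f : K, f ≠ 0 ∧ P A f = f := by
    have hPA : P A ≠ 0 := fun h => by
      refine hA0 ((hμ A hA).2 ?_)
      ext ψ
      refine ext_inner_left ℂ fun φ => ?_
      rw [hY.inner_associated hIM hA, h, show tmap (ContinuousLinearMap.id ℂ H) (0 : K →L[ℂ] K) =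
        0 from continuousLinearMap_ext_tmul fun a b => by
          rw [tmap_tmul, zero_apply, ← tmulLeft_apply, map_zero]; rfl]
      simp
    obtain ⟨f', hf'⟩ := DFunLike.ne_iff.1 hPA
    exact ⟨P A f', hf', DFunLike.congr_fun (hY.pvm.projection A hA).isIdempotentElem.eq f'⟩
  let G : H →L[ℂ] DirectIntegral μ m :=
    ContinuousLinearMap.adjoint Z.toContinuousLinearMap ∘L tmulRight H f
  -- `q h` is the part of `h ⊗ f` orthogonal to the range of `Z`, and so to that of `Y = Z J`. Its
  -- kernel consists of the `h` with `h ⊗ f` in the range of `Z`, and is infinite dimensional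
  -- because its target is not.
  let q : H →ₗ[ℂ] rangeOrthogonal Y :=
    (tmulRight H f - Z.toContinuousLinearMap ∘L G).toLinearMap.codRestrict _ fun h =>
      mem_rangeOrthogonal.2 fun ψ => by
        change ⟪Y ψ, tmulRight H f h - Z (G h)⟫_ℂ = 0
        rw [← hZJ, inner_sub_right, Z.inner_map_map, sub_eq_zero]
        exact (ContinuousLinearMap.adjoint_inner_right Z.toContinuousLinearMap _ _).symm
  obtain ⟨h, hh⟩ := exists_orthonormal_fin (mt (finiteDimensional_of_ker q) hH) (n + 1)
  have hg : ∀ i, Z (G (h i)) = tmul (h i : H) f := fun i => by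
    have := congrArg Subtype.val (LinearMap.mem_ker.1 (h i).2)
    exact (sub_eq_zero.1 this).symm
  -- The factor `⟪f, P X f⟫` does not depend on `i` and `j`, so orthonormality of the `h i` yields
  -- fibrewise orthogonality and equal fibrewise norms.
  have hin : ∀ i j, ∀ X, MeasurableSet X →
      ⟪G (h i), canonicalPVM μ m X (G (h j))⟫_ℂ = ⟪h i, h j⟫_ℂ * ⟪f, P X f⟫_ℂ :=
    fun i j X hX => by
      rw [← Z.inner_map_map, hZ X hX, hg, hg, tmap_tmul, inner_tmul]; rfl
  have h0 := canonicalPVM_apply_eq_zero_of_orthogonal hA (fun x hx => hx) (fun i => G (h i))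
    (fun i j hij X hX => by rw [hin i j X hX, hh.2 hij, zero_mul])
    (fun i X hX => by
      rw [hin i i X hX, hin 0 0 X hX, inner_self_eq_norm_sq_to_K, inner_self_eq_norm_sq_to_K,
        hh.1, hh.1])
  have h1 := hZ A hA (G (h 0))
  rw [h0, map_zero, hg, tmap_tmul, hf] at h1
  have h2 := norm_tmul (h 0 : H) f
  rw [ContinuousLinearMap.id_apply] at h1
  rw [← h1, norm_zero, ← Submodule.coe_norm, hh.1, one_mul] at h2
  exact hf0 (norm_eq_zero.1 h2.symm)

/-- If the associated observable is not rank-`∞` and `H` is infinite dimensional, the ancilla of a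
Stinespring dilation is not one-dimensional. -/
theorem exists_ne_smul_of_not_isRankInfinite
    (hM : ¬ IsRankInfinite μ M) (hμ : MutuallyAC μ M) (hIM : IsAssociated I M)
    (hY : IsStinespring I P Y) (hH : ¬ FiniteDimensional ℂ H) (ξ : K) :
    ∃ x : K, ∀ c : ℂ, x ≠ c • ξ := by
  by_contra! hall
  unfold IsRankInfinite at hM
  push Not at hM
  obtain ⟨m, hm, J, hJ, hne⟩ := hM
  obtain ⟨n, hA, hA0⟩ := exists_level_ne_zero hm (by simpa using hne)
  set A := {x | m x = n}
  -- On a space spanned by `ξ` each `P X` is a scalar, and therefore so is each `M X`. Then `J` maps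
  -- orthonormal vectors to fibrewise orthogonal sections of equal norm.
  have hMX : ∀ X, ∃ c : ℂ, MeasurableSet X → ∀ ψ φ, ⟪ψ, M X φ⟫_ℂ = c * ⟪ψ, φ⟫_ℂ := fun X => by
    obtain ⟨c, hc⟩ := hall (P X ξ)
    have h1 : tmap (ContinuousLinearMap.id ℂ H) (P X) = c • ContinuousLinearMap.id ℂ _ :=
      continuousLinearMap_ext_tmul fun a b => by
        obtain ⟨d, rfl⟩ := hall b
        rw [tmap_tmul, map_smul, hc, smul_comm, ← tmulLeft_apply, map_smul]
        rfl
    refine ⟨c, fun hX ψ φ => ?_⟩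
    rw [hY.inner_associated hIM hX, h1]
    simp [inner_smul_right]
  choose c hc using hMX
  obtain ⟨h, hh⟩ := exists_orthonormal_fin hH (n + 1)
  have h0 := canonicalPVM_apply_eq_zero_of_orthogonal hA (fun x hx => hx) (fun i => J (h i))
    (fun i j hij X hX => by rw [hJ.inner_eq hX, hc X hX, hh.2 hij, mul_zero])
    (fun i X hX => by
      rw [hJ.inner_eq hX, hJ.inner_eq hX, hc X hX, hc X hX, inner_self_eq_norm_sq_to_K,
        inner_self_eq_norm_sq_to_K, hh.1, hh.1])
  have h1 := hJ.inner_eq hA (h 0) (h 0)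
  rw [h0, inner_zero_right, hc A hA, inner_self_eq_norm_sq_to_K, hh.1] at h1
  have h2 : c A = 0 := by simpa using h1.symm
  refine hA0 ((hμ A hA).2 ?_)
  ext ψ
  refine ext_inner_left ℂ fun φ => ?_
  rw [hc A hA, h2]
  simp

end RankFinite

end QMeas

/-! ### The main theorem. -/

theorem mainTheorem4 {Ω : Type u} [MeasurableSpace Ω]
    {H : Type v} [NormedAddCommGroup H] [InnerProductSpace ℂ H] [CompleteSpace H]
    [TopologicalSpace.SeparableSpace H] [Nontrivial H]
    (I : Set Ω → traceClass H →ₗ[ℂ] traceClass H) (hI : IsInstrument I)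
    (M : Set Ω → H →L[ℂ] H) (hM : IsPOVM M) (hIM : IsAssociated I M)
    (μ : Measure Ω) [SigmaFinite μ] (hμ : MutuallyAC μ M)
    (r : Ω → ℕ∞) (hr : Measurable r)
    (Y : H →ₗᵢ[ℂ] HTensor H (DirectIntegral μ r))
    (hY : IsMinimalStinespring I (canonicalPVM μ r) Y) :
    (¬ IsRankInfinite μ M →
      (∃ ξ : DirectIntegral μ r, ‖ξ‖ = 1) ∧
      ∀ ξ : DirectIntegral μ r, ‖ξ‖ = 1 →
        (∃ U : HTensor H (DirectIntegral μ r) ≃ₗᵢ[ℂ] HTensor H (DirectIntegral μ r),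
          ∀ ψ : H, U (tmul ψ ξ) = Y ψ) ∧
        ∀ U : HTensor H (DirectIntegral μ r) ≃ₗᵢ[ℂ] HTensor H (DirectIntegral μ r),
          (∀ ψ : H, U (tmul ψ ξ) = Y ψ) →
          IsMinimalNormalRealization.{u, v, u, t} I (canonicalPVM μ r) U ξ) ∧
    (IsRankInfinite μ M →
      (∀ (U : HTensor H (DirectIntegral μ r) ≃ₗᵢ[ℂ] HTensor H (DirectIntegral μ r))
        (ξ : DirectIntegral μ r), ‖ξ‖ = 1 → (∀ ψ : H, U (tmul ψ ξ) = Y ψ) →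
        IsMinimalNormalRealization.{u, v, u, t} I (canonicalPVM μ r) U ξ) ∧
      ((¬ ∃ (U : HTensor H (DirectIntegral μ r) ≃ₗᵢ[ℂ] HTensor H (DirectIntegral μ r))
          (ξ : DirectIntegral μ r), ‖ξ‖ = 1 ∧ ∀ ψ : H, U (tmul ψ ξ) = Y ψ) →
        IsInstrument (extendInstrument I) ∧
        (∀ X : Set Ω, MeasurableSet X → extendInstrument I (some '' X) = I X) ∧
        extendInstrument I {none} = 0 ∧
        ∀ ξp : Extend (DirectIntegral μ r), ‖ξp‖ = 1 →
          (∃ Up : HTensor H (Extend (DirectIntegral μ r)) ≃ₗᵢ[ℂ]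
              HTensor H (Extend (DirectIntegral μ r)),
            ∀ ψ : H, Up (tmul ψ ξp) = extendIsometry Y ψ) ∧
          ∀ Up : HTensor H (Extend (DirectIntegral μ r)) ≃ₗᵢ[ℂ]
              HTensor H (Extend (DirectIntegral μ r)),
            (∀ ψ : H, Up (tmul ψ ξp) = extendIsometry Y ψ) →
            IsNormalRealization (extendInstrument I)
              (extendPointer (canonicalPVM μ r)) Up ξp)) := by

  have hS := hY.toIsStinespring
  have : Nontrivial (DirectIntegral μ r) := nontrivial_of_linearIsometry_hTensor Y
  refine ⟨fun hM' => ⟨exists_norm_eq _ zero_le_one, fun ξ hξ => ⟨?_, fun U hU =>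
    hY.isMinimalNormalRealization hξ hU⟩⟩, fun _ => ⟨fun U ξ hξ hU =>
    hY.isMinimalNormalRealization hξ hU, fun _ => ⟨hI.extend, fun X _ =>
    extendInstrument_some_image X, hI.extend_singleton_none, fun ξp hξp =>
    ⟨exists_unitary_extend Y hξp, fun Up hUp => ?_⟩⟩⟩⟩
  · exact exists_unitary_comp_eq (tmulRightIsometry H hξ) Y fun hH =>
      ⟨not_finiteDimensional_rangeOrthogonal_tmulRight hH hξ
        (exists_ne_smul_of_not_isRankInfinite hM' hμ hIM hS hH ξ),
        not_finiteDimensional_rangeOrthogonal_of_not_isRankInfinite hM' hμ hIM hS hH⟩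
  · refine isNormalRealization_of_dilates (isPVM_extendPointer hY.pvm) (extendIsometry Y)
      (fun S hS B => ?_) hξp hUp
    rw [adjoint_extendIsometry_comp]
    exact hY.dilates _ (measurableSet_preimage_some hS) B
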